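/- **Conventions.** Let $\mathbb R_{\max}=\mathbb R\cup\{-\infty\}$ with $a\oplus b=\max(a,b)$, $a\otimes b=a+b$; matrix products and powers are max-plus. Let $A\in\mathbb R_{\max}^{n\times n}$, and let $\mathcal D(A)$ be the weighted digraph with nodes $1,\dots,n$ and an edge $(i,j)$ of weight $a_{ij}$ whenever $a_{ij}\ne-\infty$. The length $l(W)$ of a walk is its number of edges, its weight is the sum of the weights of its edges, and its mean is weight divided by length. A cycle is a nonempty closed walk without repeated nodes (apart from start = end). Assume that $\mathcal D(A)$ has a cycle, let $\lambda(A)\in\mathbb R$ be the maximum mean of a cycle, and let the critical graph $\mathcal G^c(A)$ consist of the nodes and edges of the nonempty closed walks of mean $\lambda(A)$. "S.c.c." means strongly connected component. The cyclicity $\gamma(\mathcal G)$ of a strongly connected digraph is the gcd of the lengths of its closed walks; in general it is the lcm of the cyclicities of its s.c.c.'s. A *representing subgraph* of $\mathcal G^c(A)$ is a subgraph $\mathcal G$ with no edges between distinct s.c.c.'s and no trivial s.c.c. (a single node without a loop), such that every s.c.c. of $\mathcal G^c(A)$ contains exactly one s.c.c. of $\mathcal G$. **Weak CSR threshold.** For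 a representing subgraph $\mathcal K$ let $M=\bigoplus_{k\ge0}\big((-\lambda(A))\otimes A\big)^{\gamma(\mathcal K)k}$. Let $C$ (resp. $R$) be obtained from $M$ by replacing by $-\infty$ all columns (resp. rows) whose index is not a node of $\mathcal K$, and let $S$ have entries $a_{ij}-\lambda(A)$ on the edges of $\mathcal K$ and $-\infty$ elsewhere. $T_1(A,B)$ is the least $T\in\mathbb N$ such that $A^t=\big(t\lambda(A)\otimes CS^tR\big)\oplus B^t$ for all $t\ge T$. The statements below hold whichever representing subgraph $\mathcal K$ is used in this definition. **Schemes.** For a subgraph $\mathcal E$ of $\mathcal D(A)$, let $B$ be obtained from $A$ by setting to $-\infty$ all entries in the rows and columns of the nodes of $\mathcal E$. - Nachtigall scheme, $B=B_N$: $\mathcal E=\mathcal G^c(A)$. - Hartmann–Arguelles scheme, $B=B_{HA}$: let $V$ be a max-balancing of $A$, i.e. $v_{ij}=a_{ij}-x_i+x_j$ for some $x\in\mathbb R^n$, with $v_{ij}\le\lambda(A)$ for all $i,j$, $v_{ij}=\lambda(A)$ on the critical edges, and such that every edge $(i,j)$ of $\mathcal D(V)$ lies on a cycle all of whose edges have weight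 at least $v_{ij}$. (This scheme is considered for matrices $A$ that have a max-balancing, in particular for irreducible ones.) Let $\mathcal T(\mu)$ be the graph induced by the edges with $v_{ij}\ge\mu$. - Cycle threshold scheme, $B=B_{CT}$: let $\mathcal T(\mu)$ consist of the nodes and edges of the cycles of $\mathcal D(A)$ with mean at least $\mu$. In the last two schemes let $\mu^*$ be the greatest real $\mu\le\lambda(A)$ such that $\mathcal T(\mu)$ has an s.c.c. containing no s.c.c. of $\mathcal G^c(A)$, and let $\mathcal E$ be the union of the s.c.c.'s of $\mathcal T(\mu^*)$ that intersect $\mathcal G^c(A)$; if there is no such $\mu$, put $\mathcal D(A)$ in place of $\mathcal T(\mu^*)$. Write $\mathcal E_{CT}$ for the graph $\mathcal E$ of the cycle threshold scheme. **Thresholds.** Let $\gamma\ge1$ and let $\mathcal H$ be a subgraph of $\mathcal D(A)$. The cycle removal threshold $T^\gamma_{cr}(\mathcal H)$ (resp. the strict cycle removal threshold $\tilde T^\gamma_{cr}(\mathcal H)$) is the least $T\in\mathbb N$ such that for all $i,j$ and every walk $W$ in $\mathcal D(A)$ from $i$ to $j$ that visits a node of $\mathcal H$ and has length $\ge T$,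 there is a walk $V$ from $i$ to $j$ that visits a node of $\mathcal H$, with $l(V)\equiv l(W)\pmod\gamma$ and $l(V)\le T$, whose multiset of edges is obtained from that of $W$ by removing cycles (resp. at least one cycle) and possibly inserting cycles of $\mathcal H$. For $\mathcal H\subseteq\mathcal G^c(A)$, the exploration penalty $\mathrm{ep}^\gamma(\mathcal H)$ is the maximum over the nodes $i$ of $\mathcal H$ of the least multiple $T\in\mathbb N$ of $\gamma$ such that for every multiple $t\ge T$ of $\gamma$ there is a closed walk of length $t$ at $i$ in $\mathcal G^c(A)$. (A threshold or penalty for which no such $T$ exists is $+\infty$.) **Proposition 6.4.** (i) Let $\mathcal H_1,\dots,\mathcal H_m$ be the s.c.c.'s of a representing subgraph of $\mathcal G^c(A)$ and let $\gamma_l\ge1$ be a multiple of $\gamma(\mathcal H_l)$ for each $l$. If $B=B_N$ or $B=B_{HA}$, then $$T_1(A,B)\le\max_l\big(T^{\gamma_l}_{cr}(\mathcal H_l)-\gamma_l+1+\mathrm{ep}^{\gamma_l}(\mathcal H_l)\big).$$ (ii) If $B=B_{CT}$, then $$T_1(A,B)\le\max\big\{\tilde T^{\,l(Z)}_{cr}(Z)\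 :\ Z\text{ a cycle in }\mathcal E_{CT}\big\},$$ where a cycle $Z$ is identified with the subgraph formed by its nodes and edges. -/

import Mathlib

namespace MaxPlus

universe u

/-! ### Digraphs and walks -/

/-- A directed graph whose nodes and edges are taken from `N` and `N × N`. Loops are allowed. -/
@[ext]
structure DGraph (N : Type u) where
  nodes : Set N
  Adj : N → N → Prop
  left_mem : ∀ {i j : N}, Adj i j → i ∈ nodes
  right_mem : ∀ {i j : N}, Adj i j → j ∈ nodes

variable {N : Type u}

/-- `H ≤ G` means that `H` is a subgraph of `G`. -/
instance : PartialOrder (DGraph N) where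
  le H G := H.nodes ⊆ G.nodes ∧ ∀ i j, H.Adj i j → G.Adj i j
  le_refl _ := ⟨subset_rfl, fun _ _ h => h⟩
  le_trans _ _ _ h₁ h₂ := ⟨h₁.1.trans h₂.1, fun i j h => h₂.2 i j (h₁.2 i j h)⟩
  le_antisymm _ _ h₁ h₂ := DGraph.ext (h₁.1.antisymm h₂.1)
    (funext fun i => funext fun j => propext ⟨h₁.2 i j, h₂.2 i j⟩)

/-- The graph induced by a set of edges: its nodes are the end points of these edges. -/
def DGraph.ofEdges (r : N → N → Prop) : DGraph N where
  nodes := {i | ∃ j, r i j ∨ r j i}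
  Adj := r
  left_mem h := ⟨_, Or.inl h⟩
  right_mem h := ⟨_, Or.inr h⟩

/-- Walks in `G` from a node to a node; `nil` is the empty closed walk. -/
inductive Walk (G : DGraph N) : N → N → Type u
  | nil (i : N) (hi : i ∈ G.nodes) : Walk G i i
  | cons {i j k : N} (h : G.Adj i j) (w : Walk G j k) : Walk G i k

namespace Walk

variable {G : DGraph N}

/-- The number of edges, with multiplicity. -/
def length : {i j : N} → Walk G i j → ℕ
  | _, _, nil _ _ => 0
  | _, _, cons _ w => w.length + 1

/-- The sequence of visited nodes. -/
def support : {i j : N} → Walk G i j → List N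
  | _, _, nil i _ => [i]
  | _, _, @cons _ _ i _ _ _ w => i :: w.support

/-- The sequence of traversed edges. -/
def edges : {i j : N} → Walk G i j → List (N × N)
  | _, _, nil _ _ => []
  | _, _, @cons _ _ i j _ _ w => (i, j) :: w.edges

/-- Some node of the walk belongs to `H`. -/
def Visits {i j : N} (w : Walk G i j) (H : DGraph N) : Prop :=
  ∃ k ∈ w.support, k ∈ H.nodes

/-- A (nonempty) cycle: a nonempty closed walk with no repeated node, apart from the end point
being equal to the start point. -/
def IsCycle {i : N} (c : Walk G i i) : Prop :=
  0 < c.length ∧ c.support.tail.Nodup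

/-- The subgraph formed by the nodes and edges of a nonempty closed walk. -/
def toGraph {i : N} (c : Walk G i i) : DGraph N :=
  DGraph.ofEdges fun a b => (a, b) ∈ c.edges

end Walk

namespace DGraph

/-- Strongly connected, as a nonempty digraph. -/
def StronglyConnected (G : DGraph N) : Prop :=
  G.nodes.Nonempty ∧ ∀ i ∈ G.nodes, ∀ j ∈ G.nodes, Nonempty (Walk G i j)

/-- `H` is a strongly connected component of `G`: a maximal strongly connected subgraph. -/
def IsSCC (H G : DGraph N) : Prop :=
  Maximal (fun K : DGraph N => K ≤ G ∧ K.StronglyConnected) H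

/-- There are no edges between distinct strongly connected components. -/
def CompletelyReducible (G : DGraph N) : Prop :=
  ∀ i j, G.Adj i j → ∀ H H', IsSCC H G → IsSCC H' G → i ∈ H.nodes → j ∈ H'.nodes → H = H'

/-- The greatest common divisor of the lengths of the closed walks of `G`. -/
noncomputable def closedWalkGcd (G : DGraph N) : ℕ :=
  Nat.setGcd {L | ∃ i, ∃ c : Walk G i i, c.length = L}

/-- The cyclicity of a digraph: the least common multiple, over its strongly connected components,
of the greatest common divisors of the lengths of their closed walks. For a strongly connected
digraph that is not a single node without a loop, it is the greatest common divisor itself. -/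
noncomputable def cyclicity (G : DGraph N) : ℕ :=
  sInf {m | 0 < m ∧ ∀ H, IsSCC H G → H.closedWalkGcd ∣ m}

/-- The union of the strongly connected components of `G` that share a node with `H`. -/
def sccUnion (G H : DGraph N) : DGraph N where
  nodes := {i | ∃ K, IsSCC K G ∧ (K.nodes ∩ H.nodes).Nonempty ∧ i ∈ K.nodes}
  Adj i j := ∃ K, IsSCC K G ∧ (K.nodes ∩ H.nodes).Nonempty ∧ K.Adj i j
  left_mem := fun ⟨K, h₁, h₂, h⟩ => ⟨K, h₁, h₂, K.left_mem h⟩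
  right_mem := fun ⟨K, h₁, h₂, h⟩ => ⟨K, h₁, h₂, K.right_mem h⟩

end DGraph

/-! ### Max-plus matrices

The max-plus semiring is `WithBot ℝ`, with `⊥ = -∞`, addition `max` and multiplication `+`. -/

/-- The product of the scalar `x` (a finite one) and a matrix. -/
noncomputable def scale (x : ℝ) (A : Matrix N N (WithBot ℝ)) : Matrix N N (WithBot ℝ) :=
  fun i j => (x : WithBot ℝ) + A i j

section Matrices

variable [Fintype N]

/-- The max-plus product of matrices. -/
noncomputable def mul (A B : Matrix N N (WithBot ℝ)) : Matrix N N (WithBot ℝ) :=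
  fun i j => Finset.univ.sup fun k => A i k + B k j

/-- The max-plus identity matrix. -/
noncomputable def one [DecidableEq N] : Matrix N N (WithBot ℝ) :=
  fun i j => if i = j then 0 else ⊥

/-- The max-plus powers of a matrix. -/
noncomputable def pow [DecidableEq N] (A : Matrix N N (WithBot ℝ)) : ℕ → Matrix N N (WithBot ℝ)
  | 0 => one
  | t + 1 => mul (pow A t) A

/-- The Kleene star `I ⊕ A ⊕ A² ⊕ ⋯`. It is meaningful if the set of the entries of the powers at
each position is bounded above, which is so when no closed walk has a positive weight. -/
noncomputable def star [DecidableEq N] (A : Matrix N N (WithBot ℝ)) : Matrix N N (WithBot ℝ) :=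
  fun i j => ⨆ k : ℕ, pow A k i j

end Matrices

/-- The digraph of a matrix: all indices are nodes, and the edges are the finite entries. -/
def digraph (A : Matrix N N (WithBot ℝ)) : DGraph N where
  nodes := Set.univ
  Adj i j := A i j ≠ ⊥
  left_mem _ := Set.mem_univ _
  right_mem _ := Set.mem_univ _

/-- The weight of a walk in the digraph of `A`; all its edges have finite weights. -/
noncomputable def Walk.weight (A : Matrix N N (WithBot ℝ)) {i j : N}
    (w : Walk (digraph A) i j) : ℝ :=
  (w.edges.map fun e => (A e.1 e.2).unbotD 0).sum

/-- The mean weight of a nonempty walk. -/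
noncomputable def Walk.mean (A : Matrix N N (WithBot ℝ)) {i j : N}
    (w : Walk (digraph A) i j) : ℝ :=
  w.weight A / w.length

/-- The maximum cycle mean `λ(A)`. It is used only when there is a cycle; there are finitely many
cycle means, so that the supremum is then a maximum. -/
noncomputable def maxCycleMean (A : Matrix N N (WithBot ℝ)) : ℝ :=
  sSup {x | ∃ i, ∃ c : Walk (digraph A) i i, c.IsCycle ∧ c.mean A = x}

/-- The critical graph: the nodes and edges of the nonempty closed walks with mean `λ(A)`. -/
def crit (A : Matrix N N (WithBot ℝ)) : DGraph N :=
  DGraph.ofEdges fun a b => ∃ i, ∃ c : Walk (digraph A) i i,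
    0 < c.length ∧ c.mean A = maxCycleMean A ∧ (a, b) ∈ c.edges

/-- `G` is a representing subgraph of the critical graph of `A`: a completely reducible subgraph
with no trivial strongly connected component (a single node without a loop) such that every
strongly connected component of the critical graph contains exactly one of `G`. -/
structure IsRepresenting (A : Matrix N N (WithBot ℝ)) (G : DGraph N) : Prop where
  le_crit : G ≤ crit A
  completelyReducible : G.CompletelyReducible
  nontrivial : ∀ H, DGraph.IsSCC H G → ∃ i j, H.Adj i j
  existsUnique : ∀ C, DGraph.IsSCC C (crit A) → ∃! H, DGraph.IsSCC H G ∧ H ≤ C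

/-! ### CSR terms and the weak CSR threshold -/

/-- The least element of a set of natural numbers, or `⊤` if the set is empty. -/
noncomputable def leastNat (S : Set ℕ) : ℕ∞ :=
  sInf ((fun T : ℕ => (T : ℕ∞)) '' S)

open Classical in
/-- The matrix `S`: the entries of `λ(A)⁻ ⊗ A` at the edges of `G`. -/
noncomputable def csrS (A : Matrix N N (WithBot ℝ)) (G : DGraph N) : Matrix N N (WithBot ℝ) :=
  fun i j => if G.Adj i j then scale (-maxCycleMean A) A i j else ⊥

section CSR

variable [Fintype N] [DecidableEq N]

/-- `M = ((λ(A)⁻ ⊗ A)^γ(G))*`. -/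
noncomputable def csrM (A : Matrix N N (WithBot ℝ)) (G : DGraph N) : Matrix N N (WithBot ℝ) :=
  star (pow (scale (-maxCycleMean A) A) G.cyclicity)

open Classical in
/-- The matrix `C`: the columns of `M` with indices in `G`. -/
noncomputable def csrC (A : Matrix N N (WithBot ℝ)) (G : DGraph N) : Matrix N N (WithBot ℝ) :=
  fun i j => if j ∈ G.nodes then csrM A G i j else ⊥

open Classical in
/-- The matrix `R`: the rows of `M` with indices in `G`. -/
noncomputable def csrR (A : Matrix N N (WithBot ℝ)) (G : DGraph N) : Matrix N N (WithBot ℝ) :=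
  fun i j => if i ∈ G.nodes then csrM A G i j else ⊥

/-- The weak CSR expansion `A^t = (λ(A)^{⊗t} ⊗ C S^t R) ⊕ B^t` at time `t`, with the CSR terms of
`A` with respect to `G`. -/
def WeakCSRAt (A : Matrix N N (WithBot ℝ)) (G : DGraph N) (B : Matrix N N (WithBot ℝ))
    (t : ℕ) : Prop :=
  ∀ i j, pow A t i j =
    max (scale (t * maxCycleMean A) (mul (mul (csrC A G) (pow (csrS A G) t)) (csrR A G)) i j)
      (pow B t i j)

/-- The weak CSR threshold `T₁(A, B)`, the CSR terms being those with respect to `G`. -/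
noncomputable def T₁ (A : Matrix N N (WithBot ℝ)) (G : DGraph N)
    (B : Matrix N N (WithBot ℝ)) : ℕ∞ :=
  leastNat {T | ∀ t, T ≤ t → WeakCSRAt A G B t}

end CSR

/-! ### The three schemes -/

open Classical in
/-- The matrix obtained from `A` by cancelling the rows and columns of the nodes of `G`. -/
noncomputable def cancel (A : Matrix N N (WithBot ℝ)) (G : DGraph N) : Matrix N N (WithBot ℝ) :=
  fun i j => if i ∈ G.nodes ∨ j ∈ G.nodes then ⊥ else A i j

/-- The matrix `B` of the Nachtigall scheme. -/
noncomputable def nachtigall (A : Matrix N N (WithBot ℝ)) : Matrix N N (WithBot ℝ) :=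
  cancel A (crit A)

/-- The levels `μ ≤ λ(A)` at which the graph `thr μ` has a strongly connected component that
contains no strongly connected component of the critical graph. -/
def splitLevels (A : Matrix N N (WithBot ℝ)) (thr : ℝ → DGraph N) : Set ℝ :=
  {μ | μ ≤ maxCycleMean A ∧
    ∃ H, DGraph.IsSCC H (thr μ) ∧ ¬ ∃ C, DGraph.IsSCC C (crit A) ∧ C ≤ H}

open Classical in
/-- The threshold graph at the greatest level in `splitLevels`, and the whole digraph of `A` if
there is no such level. (The threshold graphs below change at finitely many levels only, and each
change, as the level grows, happens just above some level, so that the supremum is a maximum.) -/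
noncomputable def thresholdGraph (A : Matrix N N (WithBot ℝ)) (thr : ℝ → DGraph N) : DGraph N :=
  if (splitLevels A thr).Nonempty then thr (sSup (splitLevels A thr)) else digraph A

/-- `V` is a max-balancing of `A`: it is obtained from `A` by a diagonal similarity scaling with
finite entries, it has all its entries at most `λ(A)`, with equality on the critical edges, and it
has the cycle cover property: every edge of its digraph lies on a cycle all of whose edges have at
least the weight of this edge. -/
structure IsMaxBalancing (A V : Matrix N N (WithBot ℝ)) : Prop where
  scaling : ∃ x : N → ℝ, ∀ i j, V i j = A i j + ((x j - x i : ℝ) : WithBot ℝ)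
  le : ∀ i j, V i j ≤ (maxCycleMean A : WithBot ℝ)
  eq_of_crit : ∀ i j, (crit A).Adj i j → V i j = (maxCycleMean A : WithBot ℝ)
  cycleCover : ∀ i j, (digraph V).Adj i j → ∃ k, ∃ c : Walk (digraph V) k k,
    c.IsCycle ∧ (i, j) ∈ c.edges ∧ ∀ e ∈ c.edges, V i j ≤ V e.1 e.2

/-- The Hartmann–Arguelles threshold graph of a max-balancing `V`: it is induced by the edges of
weight at least `μ`. -/
def thrHA (V : Matrix N N (WithBot ℝ)) (μ : ℝ) : DGraph N :=
  DGraph.ofEdges fun a b => (μ : WithBot ℝ) ≤ V a b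

/-- The subgraph that defines `B` in the Hartmann–Arguelles scheme. -/
noncomputable def graphHA (A V : Matrix N N (WithBot ℝ)) : DGraph N :=
  (thresholdGraph A (thrHA V)).sccUnion (crit A)

/-- The matrix `B` of the Hartmann–Arguelles scheme, for a max-balancing `V` of `A`. -/
noncomputable def hartmannArguelles (A V : Matrix N N (WithBot ℝ)) : Matrix N N (WithBot ℝ) :=
  cancel A (graphHA A V)

/-- The cycle threshold graph: the nodes and edges of the cycles with mean at least `μ`. -/
def thrCT (A : Matrix N N (WithBot ℝ)) (μ : ℝ) : DGraph N :=
  DGraph.ofEdges fun a b => ∃ i, ∃ c : Walk (digraph A) i i,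
    c.IsCycle ∧ μ ≤ c.mean A ∧ (a, b) ∈ c.edges

/-- The subgraph that defines `B` in the cycle threshold scheme. -/
noncomputable def graphCT (A : Matrix N N (WithBot ℝ)) : DGraph N :=
  (thresholdGraph A (thrCT A)).sccUnion (crit A)

/-- The matrix `B` of the cycle threshold scheme. -/
noncomputable def cycleThreshold (A : Matrix N N (WithBot ℝ)) : Matrix N N (WithBot ℝ) :=
  cancel A (graphCT A)

/-! ### Cycle removal threshold and exploration penalty -/

/-- `E` is the multiset of the edges of a cycle of `G`. -/
def IsCycleEdges (G : DGraph N) (E : Multiset (N × N)) : Prop :=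
  ∃ i, ∃ c : Walk G i i, c.IsCycle ∧ E = (c.edges : Multiset (N × N))

/-- The walk `V` is obtained from `W` by removing the cycles in `R` and inserting cycles of `H`,
in the sense of the multigraphs formed by the edges of `V` and `W`: the removed cycles are disjoint
parts of the multiset of edges of `W`, and `V` uses the remaining edges and the inserted ones. -/
def ObtainedByRemoving {D : DGraph N} (H : DGraph N) {i j : N} (W V : Walk D i j)
    (R : Multiset (Multiset (N × N))) : Prop :=
  (∀ E ∈ R, IsCycleEdges D E) ∧ R.sum ≤ (W.edges : Multiset (N × N)) ∧
    ∃ I : Multiset (Multiset (N × N)), (∀ E ∈ I, IsCycleEdges H E) ∧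
      (V.edges : Multiset (N × N)) + R.sum = (W.edges : Multiset (N × N)) + I.sum

/-- The cycle removal threshold `T_cr^γ(H)` in the digraph of `A`. -/
noncomputable def Tcr (A : Matrix N N (WithBot ℝ)) (γ : ℕ) (H : DGraph N) : ℕ∞ :=
  leastNat {T | ∀ i j (W : Walk (digraph A) i j), W.Visits H → T ≤ W.length →
    ∃ V : Walk (digraph A) i j, V.Visits H ∧ (∃ R, ObtainedByRemoving H W V R) ∧
      V.length ≡ W.length [MOD γ] ∧ V.length ≤ T}

/-- The strict cycle removal threshold: at least one cycle has to be removed. -/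
noncomputable def strictTcr (A : Matrix N N (WithBot ℝ)) (γ : ℕ) (H : DGraph N) : ℕ∞ :=
  leastNat {T | ∀ i j (W : Walk (digraph A) i j), W.Visits H → T ≤ W.length →
    ∃ V : Walk (digraph A) i j, V.Visits H ∧ (∃ R, R ≠ 0 ∧ ObtainedByRemoving H W V R) ∧
      V.length ≡ W.length [MOD γ] ∧ V.length ≤ T}

/-- The exploration penalty of a node `i`: the least multiple `T` of `γ` such that for every
multiple `t ≥ T` of `γ` there is a closed walk of length `t` at `i` in the critical graph. -/
noncomputable def epNode (A : Matrix N N (WithBot ℝ)) (γ : ℕ) (i : N) : ℕ∞ :=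
  leastNat {T | γ ∣ T ∧ ∀ t, γ ∣ t → T ≤ t → ∃ w : Walk (crit A) i i, w.length = t}

/-- The exploration penalty of a subgraph of the critical graph. -/
noncomputable def ep (A : Matrix N N (WithBot ℝ)) (γ : ℕ) (H : DGraph N) : ℕ∞ :=
  ⨆ i ∈ H.nodes, epNode A γ i

end MaxPlus

/-! Subtract `λ(A)` from every edge weight. Closed walks then have weight at most 0
(`sum_nweight_nonpos`), and those of the critical graph have weight exactly 0 (`crit_closed_sum`),
so critical closed walks can be inserted freely. An entry of `CS^tR` is the least upper bound of the
weights of the walks, of any length in the residue class of `t` modulo `K.cyclicity`, that visit `K`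
(`sum_le_csr`, `csr_le`). By `exists_reroute` such a walk can be redirected through any node of a
critical component that it meets, which is why the choice of `K` is immaterial. Hence
`weakCSRAt_cancel` reduces the expansion at time `t` to two claims: a walk counted by the CSR term
is dominated by a walk of length exactly `t`, and a walk of length `t` that meets `E` is dominated
by a walk counted by the CSR term.

First claim: lengthen the walk by critical closed walks, cut it down by cycle removal while keeping
the residue, then fill it up to length `t`. In (i) the filling is a critical closed walk supplied by
the exploration penalty (`exists_long_of_removal`); in (ii) it consists of copies of a critical
cycle, whose length is the modulus (`exists_long_of_strictRemoval`).

Second claim: it is immediate for Nachtigall. For Hartmann–Arguelles (`exists_dominating_HA`), the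
walk is given many copies of a detour through a critical component whose balanced weights are no
smaller than its own; cycle removal brings it back to length at most `t` without loss of weight
(`exists_removal_of_detour`). For the cycle threshold scheme (`exists_visits_crit`), the walk is
moved towards a critical node along cycles of large mean, trading its own cycles for copies of them.
A trade fails only if the walk contains a cycle of larger mean; the argument then restarts at that
mean, and there are finitely many cycle means. -/

namespace MaxPlus

universe u
variable {N : Type u}

/-! ### Operations on walks -/

namespace Walk

variable {G G' : DGraph N} {i j k : N}

theorem start_mem : {i j : N} → (w : Walk G i j) → i ∈ G.nodes
  | _, _, nil _ hi => hi
  | _, _, cons h _ => G.left_mem h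

theorem end_mem : {i j : N} → (w : Walk G i j) → j ∈ G.nodes
  | _, _, nil _ hi => hi
  | _, _, cons _ w => w.end_mem

/-- Concatenation of walks. -/
def append : {i j k : N} → Walk G i j → Walk G j k → Walk G i k
  | _, _, _, nil _ _, v => v
  | _, _, _, cons h w, v => cons h (w.append v)

@[simp] theorem edges_append {i j k : N} (w : Walk G i j) (v : Walk G j k) :
    (w.append v).edges = w.edges ++ v.edges := by
  induction w with
  | nil => rfl
  | cons h w ih => simp [append, edges, ih]

theorem length_eq {i j : N} (w : Walk G i j) : w.length = w.edges.length := by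
  induction w with
  | nil => rfl
  | cons h w ih => simp [length, edges, ih]

@[simp] theorem length_append (w : Walk G i j) (v : Walk G j k) :
    (w.append v).length = w.length + v.length := by
  simp [length_eq]

theorem support_eq {i j : N} (w : Walk G i j) : w.support = i :: w.edges.map Prod.snd := by
  induction w with
  | nil => rfl
  | cons h w ih => simp [support, edges, ih]

theorem length_support (w : Walk G i j) : w.support.length = w.length + 1 := by
  simp [support_eq, length_eq]

theorem start_mem_support (w : Walk G i j) : i ∈ w.support := by
  simp [support_eq]

theorem end_mem_support {i j : N} (w : Walk G i j) : j ∈ w.support := by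
  induction w with
  | nil => simp [support]
  | cons h w ih => simp [support, ih]

theorem mem_support_of_mem_edges {i j : N} {w : Walk G i j} {e : N × N} (he : e ∈ w.edges) :
    e.1 ∈ w.support ∧ e.2 ∈ w.support := by
  induction w with
  | nil => simp [edges] at he
  | cons h w ih =>
    rcases List.mem_cons.1 he with rfl | he
    · exact ⟨by simp [support], by simp [support, start_mem_support]⟩
    · exact ⟨by simp [support, (ih he).1], by simp [support, (ih he).2]⟩

theorem mem_support_append {w : Walk G i j} {v : Walk G j k} {x : N} :
    x ∈ (w.append v).support ↔ x ∈ w.support ∨ x ∈ v.support := by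
  have : j ∈ w.support := w.end_mem_support
  simp only [support_eq, edges_append, List.map_append, List.mem_cons, List.mem_append] at this ⊢
  constructor
  · tauto
  · rintro (h | rfl | h) <;> tauto

theorem adj_of_mem_edges {i j : N} {w : Walk G i j} {e : N × N} (he : e ∈ w.edges) :
    G.Adj e.1 e.2 := by
  induction w with
  | nil => simp [edges] at he
  | cons h w ih =>
    rcases List.mem_cons.1 he with rfl | he
    · exact h
    · exact ih he

theorem support_subset {i j x : N} {w : Walk G i j} (hx : x ∈ w.support) : x ∈ G.nodes := by
  induction w with
  | nil _ hi => simp [support] at hx; exact hx ▸ hi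
  | cons h w ih =>
    rcases List.mem_cons.1 hx with rfl | hx
    · exact G.left_mem h
    · exact ih hx

theorem exists_append_of_mem_support {i j k : N} {w : Walk G i j} (hk : k ∈ w.support) :
    ∃ (p : Walk G i k) (q : Walk G k j), w = p.append q := by
  induction w with
  | nil i hi => simp [support] at hk; subst hk; exact ⟨nil _ hi, nil _ hi, rfl⟩
  | cons h w ih =>
    rcases List.mem_cons.1 hk with rfl | hk
    · exact ⟨nil _ (G.left_mem h), cons h w, rfl⟩
    · obtain ⟨p, q, rfl⟩ := ih hk
      exact ⟨cons h p, q, rfl⟩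

theorem exists_append_of_le_length {i j : N} (w : Walk G i j) {m : ℕ} (hm : m ≤ w.length) :
    ∃ (k : N) (p : Walk G i k) (q : Walk G k j), p.length = m ∧ w = p.append q := by
  induction w generalizing m with
  | nil i hi => exact ⟨i, nil i hi, nil i hi, by simp [length] at hm; simp [length, hm], rfl⟩
  | cons h w ih =>
    cases m with
    | zero => exact ⟨_, nil _ (G.left_mem h), cons h w, rfl, rfl⟩
    | succ m =>
      obtain ⟨k, p, q, hp, rfl⟩ := ih (Nat.le_of_succ_le_succ hm)
      exact ⟨k, cons h p, q, by simp [length, hp], rfl⟩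

/-- A walk with a repeated node contains a nonempty closed walk. -/
theorem exists_closed_of_not_nodup {i j : N} {w : Walk G i j} (hw : ¬ w.support.Nodup) :
    ∃ (k : N) (p : Walk G i k) (c : Walk G k k) (q : Walk G k j),
      0 < c.length ∧ w = p.append (c.append q) := by
  induction w with
  | nil => simp [support] at hw
  | @cons i j l h w ih =>
    by_cases hi : i ∈ w.support
    · obtain ⟨p, q, rfl⟩ := exists_append_of_mem_support hi
      exact ⟨i, nil i (G.left_mem h), cons h p, q, by simp [length], rfl⟩
    · have : ¬ w.support.Nodup := fun h' => hw (by simp [support, hi, h'])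
      obtain ⟨k, p, c, q, hc, rfl⟩ := ih this
      exact ⟨k, cons h p, c, q, hc, rfl⟩

/-- The closed walk that runs `n` times through a closed walk. -/
def rep (c : Walk G i i) : ℕ → Walk G i i
  | 0 => nil i c.start_mem
  | n + 1 => c.append (c.rep n)

@[simp] theorem length_rep (c : Walk G i i) (n : ℕ) : (c.rep n).length = n * c.length := by
  induction n with
  | zero => simp [rep, length]
  | succ n ih => simp [rep, ih]; ring

theorem mem_edges_of_mem_rep {c : Walk G i i} {n : ℕ} {e : N × N} (he : e ∈ (c.rep n).edges) :
    e ∈ c.edges := by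
  induction n with
  | zero => simp [rep, edges] at he
  | succ n ih =>
    simp only [rep, edges_append, List.mem_append] at he
    exact he.elim id ih

theorem mem_support_rep {c : Walk G i i} {n : ℕ} (hn : 0 < n) {x : N} (hx : x ∈ c.support) :
    x ∈ (c.rep n).support := by
  cases n with
  | zero => omega
  | succ n => exact mem_support_append.2 (Or.inl hx)

/-- Walks in different graphs have different types. Equality of the edge lists is the bridge:
lengths, supports and weights are all functions of it. -/
theorem exists_transfer {i j : N} (w : Walk G i j) (hi : i ∈ G'.nodes)
    (h : ∀ e ∈ w.edges, G'.Adj e.1 e.2) : ∃ w' : Walk G' i j, w'.edges = w.edges := by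
  induction w with
  | nil i _ => exact ⟨nil i hi, rfl⟩
  | cons hij w ih =>
    have hadj := h _ List.mem_cons_self
    obtain ⟨w', hw'⟩ := ih (G'.right_mem hadj) fun e he => h e (List.mem_cons_of_mem _ he)
    exact ⟨cons hadj w', by simp [edges, hw']⟩

theorem exists_map (w : Walk G i j) (h : G ≤ G') : ∃ w' : Walk G' i j, w'.edges = w.edges :=
  w.exists_transfer (h.1 w.start_mem) fun _ he => h.2 _ _ (adj_of_mem_edges he)

theorem length_eq_of_edges {i' j' : N} {w : Walk G i j} {w' : Walk G' i' j'}
    (h : w'.edges = w.edges) : w'.length = w.length := by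
  simp [length_eq, h]

theorem support_eq_of_edges {j' : N} {w : Walk G i j} {w' : Walk G' i j'}
    (h : w'.edges = w.edges) : w'.support = w.support := by
  simp [support_eq, h]

/-- The sum of a function over the edges of a walk. -/
def sum (f : N × N → ℝ) (w : Walk G i j) : ℝ := (w.edges.map f).sum

@[simp] theorem sum_append (f : N × N → ℝ) (w : Walk G i j) (v : Walk G j k) :
    (w.append v).sum f = w.sum f + v.sum f := by
  simp [sum]

@[simp] theorem sum_nil (f : N × N → ℝ) (hi : i ∈ G.nodes) : (nil i hi).sum f = 0 := by
  simp [sum, edges]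

@[simp] theorem sum_cons (f : N × N → ℝ) (h : G.Adj i j) (w : Walk G j k) :
    (cons h w).sum f = f (i, j) + w.sum f := by
  simp [sum, edges]

@[simp] theorem sum_rep (f : N × N → ℝ) (c : Walk G i i) (n : ℕ) :
    (c.rep n).sum f = n * c.sum f := by
  induction n with
  | zero => simp [rep]
  | succ n ih => simp [rep, ih]; ring

theorem sum_eq_of_edges {i' j' : N} {w : Walk G i j} {w' : Walk G' i' j'}
    (h : w'.edges = w.edges) (f : N × N → ℝ) : w'.sum f = w.sum f := by
  simp [sum, h]

theorem sum_le_mul {f : N × N → ℝ} {b : ℝ} {i j : N} (w : Walk G i j)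
    (h : ∀ e ∈ w.edges, f e ≤ b) : w.sum f ≤ w.length * b := by
  have := List.sum_le_card_nsmul (w.edges.map f) b fun y hy => by
    obtain ⟨e, he, rfl⟩ := List.mem_map.1 hy
    exact h e he
  simpa [sum, length_eq] using this

/-- Potentials cancel along walks. -/
theorem sum_add_potential (f : N × N → ℝ) (x : N → ℝ) {i j : N} (w : Walk G i j) :
    w.sum (fun e => f e + (x e.2 - x e.1)) = w.sum f + (x j - x i) := by
  induction w with
  | nil => simp
  | cons h w ih => simp [ih]; ring

theorem sum_sub_const (f : N × N → ℝ) (b : ℝ) {i j : N} (w : Walk G i j) :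
    w.sum (fun e => f e - b) = w.sum f - w.length * b := by
  induction w with
  | nil => simp [length]
  | cons h w ih => simp [ih, length]; ring

end Walk

/-! ### Powers of matrices and walks -/

section Pow

variable [Fintype N]

theorem add_le_mul (P Q : Matrix N N (WithBot ℝ)) (i k j : N) : P i k + Q k j ≤ mul P Q i j :=
  Finset.le_sup (f := fun k => P i k + Q k j) (Finset.mem_univ k)

theorem exists_eq_of_mul_ne_bot {P Q : Matrix N N (WithBot ℝ)} {i j : N} (h : mul P Q i j ≠ ⊥) :
    ∃ k, mul P Q i j = P i k + Q k j ∧ P i k ≠ ⊥ ∧ Q k j ≠ ⊥ := by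
  obtain ⟨k, _, hk⟩ := Finset.exists_mem_eq_sup (Finset.univ : Finset N) ⟨i, Finset.mem_univ i⟩
    fun k => P i k + Q k j
  have hk' : mul P Q i j = P i k + Q k j := hk
  rw [hk', Ne, WithBot.add_eq_bot, not_or] at h
  exact ⟨k, hk', h⟩

variable [DecidableEq N] {G : DGraph N} {Q : Matrix N N (WithBot ℝ)} {f : N × N → ℝ} {g : ℕ}

/-- The walk is cut into blocks of length `g`. The case `g = 1` serves ordinary matrices; `g =
K.cyclicity` serves the powers inside the Kleene star of the CSR terms. -/
theorem sum_le_pow (h : ∀ i j, ∀ w : Walk G i j, w.length = g → (w.sum f : WithBot ℝ) ≤ Q i j)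
    {n : ℕ} {i j : N} (w : Walk G i j) (hw : w.length = g * n) :
    (w.sum f : WithBot ℝ) ≤ pow Q n i j := by
  induction n generalizing i j with
  | zero =>
    cases w with
    | nil => simp [pow, one]
    | cons h w => simp [Walk.length] at hw
  | succ n ih =>
    obtain ⟨k, p, q, hp, rfl⟩ := w.exists_append_of_le_length (m := g * n) (by rw [hw]; gcongr; omega)
    have hq : q.length = g := by
      rw [Walk.length_append, hp, Nat.mul_succ] at hw
      omega
    rw [Walk.sum_append, WithBot.coe_add]
    exact (add_le_add (ih p hp) (h _ _ q hq)).trans (add_le_mul _ _ _ _ _)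

theorem exists_walk_of_pow_ne_bot
    (h : ∀ i j, i ∈ G.nodes → Q i j ≠ ⊥ → ∃ w : Walk G i j, w.length = g ∧ Q i j = (w.sum f : ℝ))
    {n : ℕ} {i j : N} (hi : i ∈ G.nodes) (hne : pow Q n i j ≠ ⊥) :
    ∃ w : Walk G i j, w.length = g * n ∧ pow Q n i j = (w.sum f : ℝ) := by
  induction n generalizing i j with
  | zero =>
    have hij : i = j := by
      by_contra hij
      simp [pow, one, hij] at hne
    subst hij
    exact ⟨.nil i hi, by simp [Walk.length], by simp [pow, one]⟩
  | succ n ih =>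
    obtain ⟨k, hk, h₁, h₂⟩ := exists_eq_of_mul_ne_bot hne
    obtain ⟨p, hp, hp'⟩ := ih hi h₁
    obtain ⟨q, hq, hq'⟩ := h k j p.end_mem h₂
    refine ⟨p.append q, by simp [hp, hq, Nat.mul_succ], ?_⟩
    rw [Walk.sum_append, WithBot.coe_add, ← hp', ← hq']
    exact hk

theorem sum_le_pow_of_adj (h : ∀ i j, G.Adj i j → (f (i, j) : WithBot ℝ) ≤ Q i j)
    {n : ℕ} {i j : N} (w : Walk G i j) (hw : w.length = n) :
    (w.sum f : WithBot ℝ) ≤ pow Q n i j := by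
  refine sum_le_pow (g := 1) (fun i j w hw => ?_) w (by simpa using hw)
  match w with
  | .cons hij (.nil _ _) => simpa using h _ _ hij
  | .cons _ (.cons _ w) => simp [Walk.length] at hw
  | .nil _ _ => simp [Walk.length] at hw

theorem exists_walk_of_pow_ne_bot_of_adj
    (h : ∀ i j, Q i j ≠ ⊥ → G.Adj i j ∧ Q i j = (f (i, j) : ℝ))
    {n : ℕ} {i j : N} (hi : i ∈ G.nodes) (hne : pow Q n i j ≠ ⊥) :
    ∃ w : Walk G i j, w.length = n ∧ pow Q n i j = (w.sum f : ℝ) := by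
  simpa using exists_walk_of_pow_ne_bot (g := 1) (G := G) (Q := Q) (f := f) (fun i j _ hij =>
    ⟨.cons (h i j hij).1 (.nil j (G.right_mem (h i j hij).1)), rfl, by simp [(h i j hij).2]⟩)
    hi hne

end Pow

/-! ### Normalised weights -/

section NormalisedWeights

/-- The weight of an edge in the digraph of `λ(A)⁻ ⊗ A`. -/
noncomputable def nweight (A : Matrix N N (WithBot ℝ)) (e : N × N) : ℝ :=
  (A e.1 e.2).unbotD 0 - maxCycleMean A

variable {A : Matrix N N (WithBot ℝ)}

theorem coe_unbotD_of_adj {i j : N} (h : (digraph A).Adj i j) :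
    (((A i j).unbotD 0 : ℝ) : WithBot ℝ) = A i j := by
  obtain ⟨x, hx⟩ := WithBot.ne_bot_iff_exists.1 h
  simp [← hx]

theorem scale_of_adj {i j : N} (h : (digraph A).Adj i j) :
    scale (-maxCycleMean A) A i j = (nweight A (i, j) : ℝ) := by
  rw [scale, ← coe_unbotD_of_adj h, ← WithBot.coe_add, nweight]
  congr 1; simp; ring

theorem adj_of_scale_ne_bot {x : ℝ} {i j : N} (h : scale x A i j ≠ ⊥) : (digraph A).Adj i j := by
  intro h'
  simp [scale, h'] at h

theorem sum_nweight {i j : N} (w : Walk (digraph A) i j) :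
    w.sum (nweight A) = w.weight A - w.length * maxCycleMean A :=
  w.sum_sub_const (fun e => (A e.1 e.2).unbotD 0) _

theorem mem_digraph_nodes (A : Matrix N N (WithBot ℝ)) (i : N) : i ∈ (digraph A).nodes :=
  Set.mem_univ i

theorem sum_nweight_eq_zero_iff {i : N} {c : Walk (digraph A) i i} (hc : 0 < c.length) :
    c.sum (nweight A) = 0 ↔ c.mean A = maxCycleMean A := by
  have : (0 : ℝ) < c.length := by exact_mod_cast hc
  rw [sum_nweight, Walk.mean, div_eq_iff this.ne', sub_eq_zero, mul_comm]

/-! ### Walks in the critical graph -/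

theorem crit_le_digraph (A : Matrix N N (WithBot ℝ)) : crit A ≤ digraph A :=
  ⟨fun _ _ => Set.mem_univ _, fun _ _ ⟨_, _, _, _, he⟩ => Walk.adj_of_mem_edges he⟩

/-- The edge lies on a closed walk of normalised weight 0; the rest of that walk, read cyclically
from `b`, is the return. -/
theorem crit_adj_return {a b : N} (h : (crit A).Adj a b) :
    ∃ u : Walk (crit A) b a, nweight A (a, b) + u.sum (nweight A) = 0 := by
  obtain ⟨i, c, hc, hm, he⟩ := h
  have hcrit : ∀ e ∈ c.edges, (crit A).Adj e.1 e.2 := fun e he => ⟨i, c, hc, hm, he⟩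
  obtain ⟨c', hc'⟩ := c.exists_transfer
    (by cases c with
      | nil => simp [Walk.length] at hc
      | cons h w => exact (crit A).left_mem (hcrit _ List.mem_cons_self)) hcrit
  have h₀ : c'.sum (nweight A) = 0 := by
    rw [Walk.sum_eq_of_edges hc', (sum_nweight_eq_zero_iff hc).2 hm]
  rw [← hc'] at he
  have key : ∀ {i j : N} (w : Walk (crit A) i j), (a, b) ∈ w.edges →
      ∃ (p : Walk (crit A) i a) (q : Walk (crit A) b j),
        w.sum (nweight A) = p.sum (nweight A) + (nweight A (a, b) + q.sum (nweight A)) := by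
    intro i j w hw
    induction w with
    | nil => simp [Walk.edges] at hw
    | cons h w ih =>
      rcases List.mem_cons.1 hw with hw | hw
      · cases hw
        exact ⟨.nil _ ((crit A).left_mem h), w, by simp⟩
      · obtain ⟨p, q, h'⟩ := ih hw
        exact ⟨.cons h p, q, by simp [h']; ring⟩
  obtain ⟨p, q, hpq⟩ := key c' he
  exact ⟨q.append p, by simp; linarith⟩

theorem crit_walk_return {i j : N} (w : Walk (crit A) i j) :
    ∃ u : Walk (crit A) j i, w.sum (nweight A) + u.sum (nweight A) = 0 := by
  induction w with
  | nil i hi => exact ⟨.nil i hi, by simp⟩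
  | cons h w ih =>
    obtain ⟨u, hu⟩ := ih
    obtain ⟨v, hv⟩ := crit_adj_return h
    exact ⟨u.append v, by simp; linarith⟩

theorem crit_exists_closed {i : N} (hi : i ∈ (crit A).nodes) :
    ∃ c : Walk (crit A) i i, 0 < c.length := by
  obtain ⟨j, h | h⟩ := hi
  · obtain ⟨u, -⟩ := crit_adj_return h
    exact ⟨.cons h u, by simp [Walk.length]⟩
  · obtain ⟨u, -⟩ := crit_adj_return h
    exact ⟨u.append (.cons h (.nil _ ((crit A).right_mem h))), by simp [Walk.length]⟩

/-- Closed pieces are cut out after the first edge only, so the walk stays nonempty and keeps its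
start. -/
theorem exists_isCycle_of_closed {G : DGraph N} {i : N} (c : Walk G i i) (hc : 0 < c.length) :
    ∃ z : Walk G i i, z.IsCycle := by
  induction hn : c.length using Nat.strong_induction_on generalizing c with
  | _ n ih =>
  subst hn
  cases c with
  | nil => simp [Walk.length] at hc
  | cons h w =>
    by_cases hw : w.support.Nodup
    · exact ⟨.cons h w, by simp [Walk.length], hw⟩
    · obtain ⟨k, p, c, q, hc, rfl⟩ := Walk.exists_closed_of_not_nodup hw
      exact ih (Walk.cons h (p.append q)).length (by simp [Walk.length]; omega) _
        (by simp [Walk.length]) rfl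

theorem crit_exists_isCycle {i : N} (hi : i ∈ (crit A).nodes) :
    ∃ z : Walk (crit A) i i, z.IsCycle := by
  obtain ⟨c, hc⟩ := crit_exists_closed hi
  exact exists_isCycle_of_closed c hc

/-! ### Bounds that rest on the finiteness of the node set -/

section Finite

variable [Fintype N]

theorem exists_entry_bound (A : Matrix N N (WithBot ℝ)) :
    ∃ b : ℝ, 0 ≤ b ∧ ∀ e, (A e.1 e.2).unbotD 0 ≤ b ∧ nweight A e ≤ b := by
  obtain ⟨b₁, hb₁⟩ := (Set.finite_range fun e : N × N => (A e.1 e.2).unbotD 0).bddAbove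
  obtain ⟨b₂, hb₂⟩ := (Set.finite_range (nweight A)).bddAbove
  refine ⟨max 0 (max b₁ b₂), le_max_left _ _, fun e => ⟨?_, ?_⟩⟩
  · exact (hb₁ ⟨e, rfl⟩).trans ((le_max_left _ _).trans (le_max_right _ _))
  · exact (hb₂ ⟨e, rfl⟩).trans ((le_max_right _ _).trans (le_max_right _ _))

theorem mean_le_maxCycleMean {i : N} {c : Walk (digraph A) i i} (hc : c.IsCycle) :
    c.mean A ≤ maxCycleMean A := by
  refine le_csSup ?_ ⟨i, c, hc, rfl⟩
  obtain ⟨b, -, hb⟩ := exists_entry_bound A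
  refine ⟨b, ?_⟩
  rintro _ ⟨i, c, hc, rfl⟩
  rw [Walk.mean, div_le_iff₀ (by exact_mod_cast hc.1), mul_comm]
  exact c.sum_le_mul fun e _ => (hb e).1

/-- A nonempty closed walk that is not a cycle splits into two shorter closed walks. -/
theorem sum_nweight_nonpos {i : N} (c : Walk (digraph A) i i) : c.sum (nweight A) ≤ 0 := by
  induction hn : c.length using Nat.strong_induction_on generalizing i with
  | _ n ih =>
  subst hn
  by_cases hc : c.IsCycle
  · have h : (0 : ℝ) < c.length := by exact_mod_cast hc.1
    have := mean_le_maxCycleMean hc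
    rw [Walk.mean, div_le_iff₀ h] at this
    rw [sum_nweight]
    linarith
  · cases c with
    | nil => simp
    | cons h w =>
      have hw : ¬ w.support.Nodup := fun h' => hc ⟨by simp [Walk.length], h'⟩
      obtain ⟨k, p, c, q, hc, rfl⟩ := Walk.exists_closed_of_not_nodup hw
      have h₁ := ih c.length (by simp [Walk.length]; omega) c rfl
      have h₂ := ih (Walk.cons h (p.append q)).length (by simp [Walk.length]; omega) _ rfl
      simp at h₁ h₂ ⊢
      linarith

/-- Cutting out closed pieces does not lower the weight and ends at a path with fewer than
`Fintype.card N` edges. This makes the suprema in the Kleene star bounded. -/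
theorem exists_sum_nweight_bound (A : Matrix N N (WithBot ℝ)) :
    ∃ b : ℝ, ∀ i j, ∀ w : Walk (digraph A) i j, w.sum (nweight A) ≤ b := by
  obtain ⟨b, hb₀, hb⟩ := exists_entry_bound A
  refine ⟨Fintype.card N * b, fun i j w => ?_⟩
  induction hn : w.length using Nat.strong_induction_on generalizing i j with
  | _ n ih =>
  subst hn
  by_cases hw : w.support.Nodup
  · refine (w.sum_le_mul fun e _ => (hb e).2).trans ?_
    have := hw.length_le_card
    rw [Walk.length_support] at this
    gcongr
    omega
  · obtain ⟨k, p, c, q, hc, rfl⟩ := Walk.exists_closed_of_not_nodup hw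
    have h₁ := sum_nweight_nonpos c
    have h₂ := ih (p.append q).length (by simp; omega) _ _ _ rfl
    simp at h₂ ⊢
    linarith

/-- The walk and a return of opposite weight are both closed, so both weights are nonpositive and
hence zero. -/
theorem crit_closed_sum {i : N} (c : Walk (crit A) i i) : c.sum (nweight A) = 0 := by
  obtain ⟨u, hu⟩ := crit_walk_return c
  obtain ⟨c', hc'⟩ := c.exists_map (crit_le_digraph A)
  obtain ⟨u', hu'⟩ := u.exists_map (crit_le_digraph A)
  have h₁ := sum_nweight_nonpos c'
  have h₂ := sum_nweight_nonpos u'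
  rw [Walk.sum_eq_of_edges hc'] at h₁
  rw [Walk.sum_eq_of_edges hu'] at h₂
  linarith

end Finite

end NormalisedWeights

/-! ### Strongly connected components -/

/-- The strongly connected component of a node. -/
def scc (G : DGraph N) (k : N) : DGraph N where
  nodes := {i | Nonempty (Walk G k i) ∧ Nonempty (Walk G i k)}
  Adj i j := G.Adj i j ∧ (Nonempty (Walk G k i) ∧ Nonempty (Walk G i k)) ∧
    Nonempty (Walk G k j) ∧ Nonempty (Walk G j k)
  left_mem h := h.2.1
  right_mem h := h.2.2

section SCC

variable {G H C : DGraph N} {i j k : N}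

theorem scc_le (G : DGraph N) (k : N) : scc G k ≤ G :=
  ⟨fun _ hi => hi.1.some.end_mem, fun _ _ h => h.1⟩

theorem mem_scc_self (hk : k ∈ G.nodes) : k ∈ (scc G k).nodes :=
  ⟨⟨.nil k hk⟩, ⟨.nil k hk⟩⟩

theorem exists_walk_scc (hi : i ∈ (scc G k).nodes) (hj : j ∈ (scc G k).nodes) (w : Walk G i j) :
    ∃ w' : Walk (scc G k) i j, w'.edges = w.edges := by
  have hmem : ∀ x ∈ w.support, x ∈ (scc G k).nodes := fun x hx => by
    obtain ⟨p, q, -⟩ := Walk.exists_append_of_mem_support hx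
    exact ⟨⟨hi.1.some.append p⟩, ⟨q.append hj.2.some⟩⟩
  exact w.exists_transfer hi fun e he => ⟨Walk.adj_of_mem_edges he,
    hmem _ (Walk.mem_support_of_mem_edges he).1, hmem _ (Walk.mem_support_of_mem_edges he).2⟩

theorem scc_stronglyConnected (hk : k ∈ G.nodes) : (scc G k).StronglyConnected :=
  ⟨⟨k, mem_scc_self hk⟩, fun _ hi _ hj =>
    ⟨(exists_walk_scc hi hj (hi.2.some.append hj.1.some)).choose⟩⟩

theorem le_scc (hH : H.StronglyConnected) (hle : H ≤ G) (hk : k ∈ H.nodes) : H ≤ scc G k := by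
  have h : ∀ i ∈ H.nodes, i ∈ (scc G k).nodes := fun i hi =>
    ⟨⟨((hH.2 k hk i hi).some.exists_map hle).choose⟩,
      ⟨((hH.2 i hi k hk).some.exists_map hle).choose⟩⟩
  exact ⟨h, fun i j hij => ⟨hle.2 i j hij, h i (H.left_mem hij), h j (H.right_mem hij)⟩⟩

theorem isSCC_scc (hk : k ∈ G.nodes) : DGraph.IsSCC (scc G k) G :=
  ⟨⟨scc_le G k, scc_stronglyConnected hk⟩, fun _ hH hle =>
    le_scc hH.2 hH.1 (hle.1 (mem_scc_self hk))⟩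

theorem IsSCC.eq_scc (hH : DGraph.IsSCC H G) (hk : k ∈ H.nodes) : H = scc G k :=
  hH.eq_of_le ⟨scc_le G k, scc_stronglyConnected (hH.prop.1.1 hk)⟩ (le_scc hH.prop.2 hH.prop.1 hk)

/-! ### Lengths of closed walks -/

theorem closedWalkGcd_dvd_length (c : Walk G i i) : G.closedWalkGcd ∣ c.length :=
  Nat.setGcd_dvd_of_mem ⟨i, c, rfl⟩

theorem closedWalkGcd_dvd_of_le (h : H ≤ G) : G.closedWalkGcd ∣ H.closedWalkGcd := by
  refine Nat.dvd_setGcd_iff.2 ?_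
  rintro _ ⟨i, c, rfl⟩
  obtain ⟨c', hc'⟩ := c.exists_map h
  rw [← Walk.length_eq_of_edges hc']
  exact closedWalkGcd_dvd_length c'

/-- The lengths of the closed walks at `i` form a submonoid of `ℕ`, which contains all large
multiples of its gcd. -/
theorem exists_closed_of_dvd (hG : G.StronglyConnected) (hi : i ∈ G.nodes) :
    ∃ n, ∀ m, n ≤ m → G.closedWalkGcd ∣ m → ∃ c : Walk G i i, c.length = m := by
  let S : AddSubmonoid ℕ :=
    { carrier := {m | ∃ c : Walk G i i, c.length = m}
      zero_mem' := ⟨.nil i hi, rfl⟩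
      add_mem' := by
        rintro _ _ ⟨c, rfl⟩ ⟨c', rfl⟩
        exact ⟨c.append c', by simp⟩ }
  obtain ⟨n, hn⟩ := Nat.exists_mem_closure_of_ge (S : Set ℕ)
  refine ⟨n, fun m hm hd => ?_⟩
  -- The gcd at the single node `i` is that of the whole graph: a closed walk `c` elsewhere is the
  -- difference in length of two closed walks at `i`, going to `c` and back with and without running
  -- through it.
  have hS : Nat.setGcd (S : Set ℕ) ∣ G.closedWalkGcd := by
    refine Nat.dvd_setGcd_iff.2 ?_
    rintro _ ⟨j, c, rfl⟩
    obtain ⟨u⟩ := hG.2 i hi j c.start_mem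
    obtain ⟨v⟩ := hG.2 j c.start_mem i hi
    have h₁ : Nat.setGcd (S : Set ℕ) ∣ (u.append v).length := Nat.setGcd_dvd_of_mem ⟨_, rfl⟩
    have h₂ : Nat.setGcd (S : Set ℕ) ∣ (u.append (c.append v)).length :=
      Nat.setGcd_dvd_of_mem ⟨_, rfl⟩
    have h₃ : (u.append (c.append v)).length = (u.append v).length + c.length := by simp; omega
    exact (Nat.dvd_add_right h₁).1 (h₃ ▸ h₂)
  have := hn m hm (hS.trans hd)
  rwa [AddSubmonoid.closure_eq] at this

theorem closedWalkGcd_pos {c : Walk G i i} (hc : 0 < c.length) : 0 < G.closedWalkGcd :=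
  Nat.pos_of_dvd_of_pos (closedWalkGcd_dvd_length c) hc

theorem StronglyConnected.exists_closed (hG : G.StronglyConnected) (he : ∃ a b, G.Adj a b)
    (hi : i ∈ G.nodes) : ∃ c : Walk G i i, 0 < c.length := by
  obtain ⟨a, b, hab⟩ := he
  obtain ⟨u⟩ := hG.2 i hi a (G.left_mem hab)
  obtain ⟨v⟩ := hG.2 b (G.right_mem hab) i hi
  exact ⟨u.append (.cons hab v), by simp [Walk.length]⟩

/-- If no positive common multiple exists, the infimum of the empty set is 0, which everything
divides. -/
theorem closedWalkGcd_dvd_cyclicity (hH : DGraph.IsSCC H G) :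
    H.closedWalkGcd ∣ G.cyclicity := by
  by_cases hne : {m | 0 < m ∧ ∀ H, DGraph.IsSCC H G → H.closedWalkGcd ∣ m}.Nonempty
  · exact (Nat.sInf_mem hne).2 H hH
  · rw [Set.not_nonempty_iff_eq_empty] at hne
    rw [DGraph.cyclicity, hne]
    simp

/-- Nontrivial components have positive gcds, so the product over all nodes is a positive common
multiple. -/
theorem cyclicity_pos [Fintype N] (hG : ∀ H, DGraph.IsSCC H G → ∃ i j, H.Adj i j) :
    0 < G.cyclicity := by
  classical
  refine (Nat.sInf_mem (s := {m | 0 < m ∧ ∀ H, DGraph.IsSCC H G → H.closedWalkGcd ∣ m})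
    ⟨∏ k with k ∈ G.nodes, (scc G k).closedWalkGcd, Finset.prod_pos fun k hk => ?_,
      fun H hH => ?_⟩).1
  · have hk' := (Finset.mem_filter.1 hk).2
    obtain ⟨c, hc⟩ := StronglyConnected.exists_closed (scc_stronglyConnected hk')
      (hG _ (isSCC_scc hk')) (mem_scc_self hk')
    exact closedWalkGcd_pos hc
  · obtain ⟨k, hk⟩ := hH.prop.2.1
    rw [IsSCC.eq_scc hH hk]
    exact Finset.dvd_prod_of_mem (fun k => (scc G k).closedWalkGcd)
      (Finset.mem_filter.2 ⟨Finset.mem_univ k, hH.prop.1.1 hk⟩)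

theorem isSCC_self (hH : DGraph.IsSCC H G) : DGraph.IsSCC H H :=
  ⟨⟨le_rfl, hH.prop.2⟩, fun _ hK _ => hK.1⟩

end SCC

/-- Inserting critical closed walks, a walk through a component of the critical graph can be
rerouted through another node of this component, with a prescribed residue of the length. -/
theorem exists_reroute [Fintype N] {A : Matrix N N (WithBot ℝ)} {C : DGraph N}
    (hC : DGraph.IsSCC C (crit A)) {i j k h : N} (X : Walk (digraph A) i j) (hkX : k ∈ X.support)
    (hk : k ∈ C.nodes) (hh : h ∈ C.nodes) {γ t : ℕ} (hγ : 0 < γ) (hd : C.closedWalkGcd ∣ γ)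
    (hX : X.length ≡ t [MOD C.closedWalkGcd]) (L : ℕ) :
    ∃ Y : Walk (digraph A) i j, Y.sum (nweight A) = X.sum (nweight A) ∧ h ∈ Y.support ∧
      Y.length ≡ t [MOD γ] ∧ L ≤ Y.length := by
  obtain ⟨p, q, rfl⟩ := Walk.exists_append_of_mem_support hkX
  obtain ⟨u⟩ := hC.prop.2.2 k hk h hh
  obtain ⟨v⟩ := hC.prop.2.2 h hh k hk
  obtain ⟨n, hn⟩ := exists_closed_of_dvd hC.prop.2 hh
  set s := p.length + q.length + (u.length + v.length) with hs
  have huv := closedWalkGcd_dvd_length (u.append v)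
  have hst : s ≡ t [MOD C.closedWalkGcd] := by
    have := hX.add ((Nat.modEq_zero_iff_dvd).2 huv)
    simpa [hs] using this
  -- The length of the closed walk to insert at `h`. It makes the total `t + γ * (s + L + n)`,
  -- avoids the subtraction `t - s`, and is at least `n`, so that the closed walk exists.
  set m := t + s * (γ - 1) + γ * (L + n) with hm
  have hsm : s + m = t + γ * (s + L + n) := by
    obtain ⟨γ, rfl⟩ : ∃ a, γ = a + 1 := ⟨γ - 1, by omega⟩
    simp only [hm, Nat.add_sub_cancel]
    ring
  have hdm : C.closedWalkGcd ∣ m := by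
    have h₁ : s + m ≡ s + 0 [MOD C.closedWalkGcd] := by
      rw [hsm]
      refine Nat.ModEq.trans ?_ (hst.symm)
      exact (Nat.ModEq.refl t).add ((Nat.modEq_zero_iff_dvd).2 (hd.mul_right _))
    exact (Nat.modEq_zero_iff_dvd).1 (Nat.ModEq.add_left_cancel' s h₁)
  have hLn : L + n ≤ γ * (L + n) := Nat.le_mul_of_pos_left _ hγ
  obtain ⟨z, hz⟩ := hn m (by omega) hdm
  obtain ⟨D, hD⟩ := (u.append (z.append v)).exists_map hC.prop.1
  obtain ⟨E, hE⟩ := D.exists_map (crit_le_digraph A)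
  have hEs : E.sum (nweight A) = 0 := by rw [Walk.sum_eq_of_edges hE, crit_closed_sum]
  have hEl : E.length = u.length + v.length + m := by
    rw [Walk.length_eq_of_edges hE, Walk.length_eq_of_edges hD]
    simp [hz]; omega
  have hEh : h ∈ E.support := by
    rw [Walk.support_eq_of_edges hE, Walk.support_eq_of_edges hD, Walk.mem_support_append]
    exact Or.inl u.end_mem_support
  refine ⟨p.append (E.append q), by simp [hEs], ?_, ?_, by simp; omega⟩
  · simp [Walk.mem_support_append, hEh]
  · have : (p.append (E.append q)).length = t + γ * (s + L + n) := by
      rw [← hsm]; simp [hEl, hs]; omega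
    rw [this]
    exact (Nat.ModEq.refl t).add ((Nat.modEq_zero_iff_dvd).2 (Dvd.intro _ rfl))

/-! ### CSR terms and walks -/

theorem withBot_add_coe_le_iff {x a : WithBot ℝ} {s : ℝ} :
    x + (s : WithBot ℝ) ≤ a ↔ x ≤ a + ((-s : ℝ) : WithBot ℝ) := by
  induction x using WithBot.recBotCoe with
  | bot => simp
  | coe x =>
    induction a using WithBot.recBotCoe with
    | bot => simp [← WithBot.coe_add]
    | coe a =>
      rw [← WithBot.coe_add, ← WithBot.coe_add, WithBot.coe_le_coe, WithBot.coe_le_coe]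
      constructor <;> intro h <;> linarith

section CSRWalks

variable {A : Matrix N N (WithBot ℝ)} {K : DGraph N} {i j k : N}

theorem csrS_of_adj (hK : K ≤ digraph A) (h : K.Adj i j) : csrS A K i j = (nweight A (i, j) : ℝ) := by
  rw [csrS, if_pos h, scale_of_adj (hK.2 _ _ h)]

theorem adj_of_csrS_ne_bot (h : csrS A K i j ≠ ⊥) : K.Adj i j := by
  by_contra h'
  simp [csrS, h'] at h

variable [Fintype N] [DecidableEq N]

theorem exists_walk_of_pow_scale_ne_bot {g : ℕ} (h : pow (scale (-maxCycleMean A) A) g i j ≠ ⊥) :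
    ∃ w : Walk (digraph A) i j, w.length = g ∧
      pow (scale (-maxCycleMean A) A) g i j = (w.sum (nweight A) : ℝ) :=
  exists_walk_of_pow_ne_bot_of_adj (fun _ _ h => ⟨adj_of_scale_ne_bot h,
    scale_of_adj (adj_of_scale_ne_bot h)⟩) (mem_digraph_nodes A i) h

theorem exists_walk_of_pow_pow_ne_bot {g n : ℕ}
    (h : pow (pow (scale (-maxCycleMean A) A) g) n i j ≠ ⊥) :
    ∃ w : Walk (digraph A) i j, w.length = g * n ∧
      pow (pow (scale (-maxCycleMean A) A) g) n i j = (w.sum (nweight A) : ℝ) :=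
  exists_walk_of_pow_ne_bot (fun _ _ _ h => exists_walk_of_pow_scale_ne_bot h)
    (mem_digraph_nodes A i) h

theorem sum_le_csrM (w : Walk (digraph A) i j) (hw : K.cyclicity ∣ w.length) :
    (w.sum (nweight A) : WithBot ℝ) ≤ csrM A K i j := by
  obtain ⟨n, hn⟩ := hw
  refine (sum_le_pow (Q := pow (scale (-maxCycleMean A) A) K.cyclicity) (fun i j w hw =>
    sum_le_pow_of_adj (fun i j hij => (scale_of_adj hij).ge) w hw) w hn).trans ?_
  refine le_ciSup (f := fun n => pow (pow (scale (-maxCycleMean A) A) K.cyclicity) n i j) ?_ n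
  obtain ⟨b, hb⟩ := exists_sum_nweight_bound A
  refine ⟨b, ?_⟩
  rintro _ ⟨n, rfl⟩
  by_cases h : pow (pow (scale (-maxCycleMean A) A) K.cyclicity) n i j = ⊥
  · simp [h]
  · obtain ⟨w, -, hw⟩ := exists_walk_of_pow_pow_ne_bot h
    simp only [hw]
    exact_mod_cast hb i j w

/-- The finite summand `s` is moved to the other side, because only the entry of `M` itself is a
supremum. -/
theorem csrM_add_le {s a : WithBot ℝ} (h : ∀ w : Walk (digraph A) i j, K.cyclicity ∣ w.length →
    (w.sum (nweight A) : WithBot ℝ) + s ≤ a) : csrM A K i j + s ≤ a := by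
  induction s using WithBot.recBotCoe with
  | bot => simp
  | coe s =>
    rw [withBot_add_coe_le_iff]
    refine ciSup_le fun n => ?_
    by_cases h' : pow (pow (scale (-maxCycleMean A) A) K.cyclicity) n i j = ⊥
    · simp [h']
    · obtain ⟨w, hw, hw'⟩ := exists_walk_of_pow_pow_ne_bot h'
      rw [hw', ← withBot_add_coe_le_iff]
      exact h w ⟨n, hw⟩

/-- The CSR term bounds the normalised weights of the walks through `K`, in the residue class. -/
theorem sum_le_csr (hK : IsRepresenting A K) {t : ℕ} (X : Walk (digraph A) i j)
    (hkX : k ∈ X.support) (hk : k ∈ K.nodes) (hX : X.length ≡ t [MOD K.cyclicity]) :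
    (X.sum (nweight A) : WithBot ℝ) ≤
      mul (mul (csrC A K) (pow (csrS A K) t)) (csrR A K) i j := by
  have hKA : K ≤ digraph A := hK.le_crit.trans (crit_le_digraph A)
  obtain ⟨p, q, rfl⟩ := Walk.exists_append_of_mem_support hkX
  have hg : 0 < K.cyclicity := cyclicity_pos hK.nontrivial
  have hH := isSCC_scc hk
  obtain ⟨n, hn⟩ := exists_closed_of_dvd hH.prop.2 (mem_scc_self hk)
  have hd := closedWalkGcd_dvd_cyclicity hH
  generalize hgeq : K.cyclicity = g at *
  set a := p.length
  set b := q.length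
  have hc : a + (a * (g - 1)) = g * a := by
    obtain ⟨g, rfl⟩ : ∃ c, g = c + 1 := ⟨g - 1, by omega⟩
    simp only [Nat.add_sub_cancel]; ring
  have hc' : b + (b * (g - 1)) = g * b := by
    obtain ⟨g, rfl⟩ : ∃ c, g = c + 1 := ⟨g - 1, by omega⟩
    simp only [Nat.add_sub_cancel]; ring
  -- A critical closed walk of length `a * (g - 1) + t + d` is inserted at `k` and cut into three.
  -- Its first part completes `p` to length `g * a`, its last part completes `q` to length `g * (b +
  -- n)`, and the middle part, of length `t`, is read by `S^t`. The summand `g * n` makes it long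
  -- enough to exist.
  set d := b * (g - 1) + g * n with hdd
  have hab : a + b ≡ t [MOD g] := by simpa using hX
  have hL : (scc K k).closedWalkGcd ∣ a * (g - 1) + (t + d) := by
    refine hd.trans ((Nat.modEq_zero_iff_dvd).1 ?_)
    refine Nat.ModEq.add_left_cancel' (a + b) ?_
    have : a + b + (a * (g - 1) + (t + d)) = t + g * (a + b + n) := by
      rw [hdd, mul_add, mul_add, ← hc, ← hc']; ring
    rw [this]
    exact ((Nat.ModEq.refl t).add ((Nat.modEq_zero_iff_dvd).2 (Dvd.intro _ rfl))).trans hab.symm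
  have hgn : n ≤ g * n := Nat.le_mul_of_pos_left _ hg
  obtain ⟨Y, hY⟩ := hn _ (by omega) hL
  obtain ⟨Y', hY'⟩ := Y.exists_map (scc_le K k)
  obtain ⟨Y'', hY''⟩ := Y'.exists_map hK.le_crit
  have hY0 : Y'.sum (nweight A) = 0 := by
    rw [← Walk.sum_eq_of_edges hY'', crit_closed_sum]
  rw [← Walk.length_eq_of_edges hY'] at hY
  obtain ⟨l, y₁, y', hy₁, rfl⟩ := Y'.exists_append_of_le_length (m := a * (g - 1)) (by omega)
  have hy' : y'.length = t + d := by simp at hY; omega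
  obtain ⟨m, y₂, y₃, hy₂, rfl⟩ := y'.exists_append_of_le_length (m := t) (by omega)
  have hy₃ : y₃.length = d := by simp at hy'; omega
  obtain ⟨z₁, hz₁⟩ := y₁.exists_map hKA
  obtain ⟨z₃, hz₃⟩ := y₃.exists_map hKA
  have h₁ : ((p.append z₁).sum (nweight A) : WithBot ℝ) ≤ csrC A K i l := by
    rw [csrC, if_pos y₁.end_mem]
    refine sum_le_csrM _ ?_
    rw [hgeq, Walk.length_append, Walk.length_eq_of_edges hz₁, hy₁]
    exact ⟨a, hc⟩
  have h₃ : ((z₃.append q).sum (nweight A) : WithBot ℝ) ≤ csrR A K m j := by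
    rw [csrR, if_pos y₃.start_mem]
    refine sum_le_csrM _ ?_
    rw [hgeq, Walk.length_append, Walk.length_eq_of_edges hz₃, hy₃]
    exact ⟨b + n, by rw [mul_add, ← hc', hdd]; ring⟩
  have h₂ : (y₂.sum (nweight A) : WithBot ℝ) ≤ pow (csrS A K) t l m :=
    sum_le_pow_of_adj (fun _ _ h => (csrS_of_adj hKA h).ge) y₂ hy₂
  have h₀ : (p.append q).sum (nweight A) = (p.append z₁).sum (nweight A) + y₂.sum (nweight A) +
      (z₃.append q).sum (nweight A) := by
    simp [Walk.sum_eq_of_edges hz₁, Walk.sum_eq_of_edges hz₃] at hY0 ⊢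
    linarith
  rw [h₀, WithBot.coe_add, WithBot.coe_add]
  exact (add_le_add ((add_le_add h₁ h₂).trans (add_le_mul _ _ _ _ _)) h₃).trans
    (add_le_mul _ _ _ _ _)

/-- The CSR term is the least bound of the walks through `K`, in the residue class. -/
theorem csr_le (hK : IsRepresenting A K) {t : ℕ} {a : WithBot ℝ}
    (h : ∀ X : Walk (digraph A) i j, X.Visits K → X.length ≡ t [MOD K.cyclicity] →
      (X.sum (nweight A) : WithBot ℝ) ≤ a) :
    mul (mul (csrC A K) (pow (csrS A K) t)) (csrR A K) i j ≤ a := by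
  have hKA : K ≤ digraph A := hK.le_crit.trans (crit_le_digraph A)
  by_cases hne : mul (mul (csrC A K) (pow (csrS A K) t)) (csrR A K) i j = ⊥
  · simp [hne]
  obtain ⟨m, hm, hm₁, hm₂⟩ := exists_eq_of_mul_ne_bot hne
  obtain ⟨l, hl, hl₁, hl₂⟩ := exists_eq_of_mul_ne_bot hm₁
  have hlK : l ∈ K.nodes := by
    by_contra h'
    simp [csrC, h'] at hl₁
  have hmK : m ∈ K.nodes := by
    by_contra h'
    simp [csrR, h'] at hm₂
  obtain ⟨y, hy, hy'⟩ := exists_walk_of_pow_ne_bot_of_adj (fun _ _ h => ⟨adj_of_csrS_ne_bot h,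
    csrS_of_adj hKA (adj_of_csrS_ne_bot h)⟩) hlK hl₂
  obtain ⟨y', hyy'⟩ := y.exists_map hKA
  rw [hm, hl, csrC, if_pos hlK, csrR, if_pos hmK, hy', add_assoc]
  refine csrM_add_le fun p hp => ?_
  rw [← add_assoc, add_comm]
  refine csrM_add_le fun q hq => ?_
  have hsum : (p.append (y'.append q)).sum (nweight A) =
      q.sum (nweight A) + (p.sum (nweight A) + y.sum (nweight A)) := by
    simp [Walk.sum_eq_of_edges hyy']; ring
  have := h (p.append (y'.append q)) ⟨l, Walk.mem_support_append.2 (Or.inl p.end_mem_support), hlK⟩ <| by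
    rw [Walk.length_append, Walk.length_append, Walk.length_eq_of_edges hyy', hy]
    have h₁ := (Nat.modEq_zero_iff_dvd).2 hp
    have h₂ := (Nat.modEq_zero_iff_dvd).2 hq
    simpa using h₁.add ((Nat.ModEq.refl t).add h₂)
  rwa [hsum, WithBot.coe_add, WithBot.coe_add] at this

end CSRWalks

/-! ### Reduction of the weak CSR expansion to walks -/

section Reduction

theorem visits_of_le {G H H' : DGraph N} {i j : N} {w : Walk G i j} (h : w.Visits H)
    (hle : H ≤ H') : w.Visits H' :=
  let ⟨k, hk, hk'⟩ := h
  ⟨k, hk, hle.1 hk'⟩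

/-- A component of the critical graph contains a component of a representing subgraph. -/
theorem exists_representative {A : Matrix N N (WithBot ℝ)} {G C : DGraph N}
    (hG : IsRepresenting A G) (hC : DGraph.IsSCC C (crit A)) :
    ∃ H, DGraph.IsSCC H G ∧ H ≤ C :=
  (hG.existsUnique C hC).exists

theorem closedWalkGcd_dvd_rep_cyclicity {A : Matrix N N (WithBot ℝ)} {K C : DGraph N}
    (hK : IsRepresenting A K) (hC : DGraph.IsSCC C (crit A)) :
    C.closedWalkGcd ∣ K.cyclicity := by
  obtain ⟨H, hH, hHC⟩ := exists_representative hK hC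
  exact (closedWalkGcd_dvd_of_le hHC).trans (closedWalkGcd_dvd_cyclicity hH)

theorem adj_of_cancel_ne_bot {A : Matrix N N (WithBot ℝ)} {E : DGraph N} {a b : N}
    (h : cancel A E a b ≠ ⊥) : (digraph A).Adj a b ∧ cancel A E a b = A a b := by
  rw [cancel] at h ⊢
  split_ifs at h ⊢
  · exact absurd rfl h
  · exact ⟨h, rfl⟩

variable [Fintype N] [DecidableEq N] {A : Matrix N N (WithBot ℝ)} {K : DGraph N}

/-- A walk of length `t` that avoids `E` is a walk in the digraph of `B`; one that meets `E` must be
matched by the CSR term, which is `hlb`. Conversely `hub` bounds the CSR term by `A^t`. In `hlb` the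
residue is needed only modulo the gcd of the critical component, since rerouting adjusts it to
`K.cyclicity`. -/
theorem weakCSRAt_cancel (hK : IsRepresenting A K) (E : DGraph N) {t : ℕ}
    (hub : ∀ i j, ∀ X : Walk (digraph A) i j, X.Visits K → X.length ≡ t [MOD K.cyclicity] →
      ∃ Y : Walk (digraph A) i j, Y.length = t ∧ X.sum (nweight A) ≤ Y.sum (nweight A))
    (hlb : 0 < t → ∀ i j, ∀ W : Walk (digraph A) i j, W.length = t → W.Visits E →
      ∃ X : Walk (digraph A) i j, ∃ C, DGraph.IsSCC C (crit A) ∧ X.Visits C ∧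
        X.length ≡ t [MOD C.closedWalkGcd] ∧ W.sum (nweight A) ≤ X.sum (nweight A)) :
    WeakCSRAt A K (cancel A E) t := by
  intro i j
  have hweight : ∀ {i j : N} (w : Walk (digraph A) i j), w.length = t →
      w.sum (fun e => (A e.1 e.2).unbotD 0) = t * maxCycleMean A + w.sum (nweight A) := by
    intro i j w hw
    have := sum_nweight w
    rw [hw] at this
    have h' : w.sum (fun e => (A e.1 e.2).unbotD 0) = w.weight A := rfl
    linarith
  have hpow : ∀ {i j : N} (w : Walk (digraph A) i j), w.length = t →
      (w.sum (fun e => (A e.1 e.2).unbotD 0) : WithBot ℝ) ≤ pow A t i j := fun w hw =>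
    sum_le_pow_of_adj (fun _ _ h => (coe_unbotD_of_adj h).le) w hw
  refine le_antisymm ?_ (max_le ?_ ?_)
  · by_cases hne : pow A t i j = ⊥
    · simp [hne]
    -- At time 0 the powers of `A` and `B` are both the identity.
    rcases Nat.eq_zero_or_pos t with rfl | ht
    · exact le_max_right _ _
    obtain ⟨W, hW, hW'⟩ := exists_walk_of_pow_ne_bot_of_adj (Q := A) (G := digraph A)
      (f := fun e => (A e.1 e.2).unbotD 0) (fun _ _ h => ⟨h, (coe_unbotD_of_adj h).symm⟩)
      (mem_digraph_nodes A i) hne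
    by_cases hE : W.Visits E
    · refine le_max_of_le_left ?_
      obtain ⟨X, C, hC, ⟨k, hkX, hk⟩, hX, hWX⟩ := hlb ht i j W hW hE
      obtain ⟨H, hH, hHC⟩ := exists_representative hK hC
      obtain ⟨h, hh⟩ := hH.prop.2.1
      obtain ⟨Y, hY, hhY, hYt, -⟩ := exists_reroute hC X hkX hk (hHC.1 hh)
        (cyclicity_pos hK.nontrivial) (closedWalkGcd_dvd_rep_cyclicity hK hC) hX 0
      have hle := sum_le_csr hK Y hhY (hH.prop.1.1 hh) hYt
      rw [hW', hweight W hW, WithBot.coe_add, scale]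
      refine add_le_add le_rfl (le_trans ?_ hle)
      rw [hY]
      exact_mod_cast hWX
    · refine le_max_of_le_right ?_
      have hout : ∀ x ∈ W.support, x ∉ E.nodes := fun x hx hxE => hE ⟨x, hx, hxE⟩
      obtain ⟨W', hWW'⟩ := W.exists_transfer (mem_digraph_nodes (cancel A E) i) fun e he => by
        have h := Walk.mem_support_of_mem_edges he
        have := Walk.adj_of_mem_edges he
        change cancel A E e.1 e.2 ≠ ⊥
        rw [cancel, if_neg (not_or.2 ⟨hout _ h.1, hout _ h.2⟩)]
        exact this
      rw [hW', ← Walk.sum_eq_of_edges hWW']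
      refine sum_le_pow_of_adj (fun a b hab => ?_) W' (by rw [Walk.length_eq_of_edges hWW', hW])
      obtain ⟨hadj, hab'⟩ := adj_of_cancel_ne_bot hab
      exact ((coe_unbotD_of_adj hadj).trans hab'.symm).le
  · rw [scale, add_comm, withBot_add_coe_le_iff]
    refine csr_le hK fun X hX hXt => ?_
    obtain ⟨Y, hY, hXY⟩ := hub i j X hX hXt
    rw [← withBot_add_coe_le_iff]
    refine le_trans ?_ (hpow Y hY)
    rw [hweight Y hY, ← WithBot.coe_add, WithBot.coe_le_coe]
    linarith
  · by_cases hne : pow (cancel A E) t i j = ⊥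
    · simp [hne]
    obtain ⟨W, hW, hW'⟩ := exists_walk_of_pow_ne_bot_of_adj (Q := cancel A E) (G := digraph A)
      (f := fun e => (A e.1 e.2).unbotD 0)
      (fun a b h => ⟨(adj_of_cancel_ne_bot h).1, (adj_of_cancel_ne_bot h).2.trans
        (coe_unbotD_of_adj (adj_of_cancel_ne_bot h).1).symm⟩)
      (mem_digraph_nodes A i) hne
    rw [hW']
    exact hpow W hW

end Reduction

/-! ### Removing and inserting cycles -/

theorem exists_mem_le_of_leastNat_le {S : Set ℕ} {T : ℕ} (h : leastNat S ≤ T) :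
    ∃ τ ∈ S, τ ≤ T := by
  by_contra! hS
  have : ((T + 1 : ℕ) : ℕ∞) ≤ leastNat S := by
    refine le_sInf ?_
    rintro _ ⟨τ, hτ, rfl⟩
    exact Nat.cast_le.2 (hS τ hτ)
  have := this.trans h
  norm_cast at this
  omega

theorem leastNat_le {S : Set ℕ} {T : ℕ} (h : T ∈ S) : leastNat S ≤ T :=
  sInf_le ⟨T, h, rfl⟩

theorem sum_map_multiset_sum (f : N × N → ℝ) (R : Multiset (Multiset (N × N))) :
    (R.sum.map f).sum = (R.map fun E => (E.map f).sum).sum := by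
  induction R using Multiset.induction with
  | empty => simp
  | cons E R ih => simp [ih]

section Removing

variable {D H : DGraph N} {i j : N} {W V : Walk D i j} {R I : Multiset (Multiset (N × N))}

theorem Walk.sum_eq_multiset (f : N × N → ℝ) (w : Walk D i j) :
    w.sum f = ((w.edges : Multiset (N × N)).map f).sum := by
  simp [Walk.sum]

theorem sum_add_of_edges_eq
    (h : (V.edges : Multiset (N × N)) + R.sum = (W.edges : Multiset (N × N)) + I.sum)
    (f : N × N → ℝ) :
    V.sum f + (R.sum.map f).sum = W.sum f + (I.sum.map f).sum := by
  rw [Walk.sum_eq_multiset, Walk.sum_eq_multiset, ← Multiset.sum_add, ← Multiset.map_add, h,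
    Multiset.map_add, Multiset.sum_add]

theorem multiset_sum_map_nonpos {f : N × N → ℝ} (hR : ∀ E ∈ R, (E.map f).sum ≤ 0) :
    (R.sum.map f).sum ≤ 0 := by
  rw [sum_map_multiset_sum]
  refine Multiset.sum_induction (· ≤ 0) _ (fun a b ha hb => by linarith) le_rfl fun x hx => ?_
  obtain ⟨E, hE, rfl⟩ := Multiset.mem_map.1 hx
  exact hR E hE

theorem multiset_sum_map_eq_zero {f : N × N → ℝ} (hR : ∀ E ∈ R, (E.map f).sum = 0) :
    (R.sum.map f).sum = 0 := by
  rw [sum_map_multiset_sum]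
  refine Multiset.sum_eq_zero fun x hx => ?_
  obtain ⟨E, hE, rfl⟩ := Multiset.mem_map.1 hx
  exact hR E hE

theorem cycles_sum_le {G : DGraph N} {f : N × N → ℝ} (hR : ∀ E ∈ R, IsCycleEdges G E)
    (hf : ∀ i, ∀ c : Walk G i i, c.IsCycle → c.sum f ≤ 0) : (R.sum.map f).sum ≤ 0 :=
  multiset_sum_map_nonpos fun E hE => by
    obtain ⟨i, c, hc, rfl⟩ := hR E hE
    rw [← Walk.sum_eq_multiset]
    exact hf i c hc

theorem cycles_sum_eq {G : DGraph N} {f : N × N → ℝ} (hR : ∀ E ∈ R, IsCycleEdges G E)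
    (hf : ∀ i, ∀ c : Walk G i i, c.IsCycle → c.sum f = 0) : (R.sum.map f).sum = 0 :=
  multiset_sum_map_eq_zero fun E hE => by
    obtain ⟨i, c, hc, rfl⟩ := hR E hE
    rw [← Walk.sum_eq_multiset]
    exact hf i c hc

theorem multiset_sum_le_of_le {S T : Multiset (N × N)} (h : S ≤ T) {f : N × N → ℝ}
    (hf : ∀ e, 0 ≤ f e) : (S.map f).sum ≤ (T.map f).sum := by
  obtain ⟨U, rfl⟩ := Multiset.le_iff_exists_add.1 h
  rw [Multiset.map_add, Multiset.sum_add, le_add_iff_nonneg_right]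
  exact Multiset.sum_nonneg fun x hx => by
    obtain ⟨e, -, rfl⟩ := Multiset.mem_map.1 hx
    exact hf e

variable {A : Matrix N N (WithBot ℝ)}

/-- Potentials cancel on closed walks, so inserted critical cycles weigh nothing in any diagonal
scaling. -/
theorem crit_cycles_sum [Fintype N] (hH : H ≤ crit A) (hI : ∀ E ∈ I, IsCycleEdges H E) (x : N → ℝ) :
    (I.sum.map fun e => nweight A e + (x e.2 - x e.1)).sum = 0 :=
  cycles_sum_eq hI fun i c _ => by
    obtain ⟨c', hc'⟩ := c.exists_map hH
    rw [Walk.sum_add_potential, ← Walk.sum_eq_of_edges hc', crit_closed_sum]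
    ring

/-- Removing cycles and inserting critical cycles does not decrease the normalised weight. -/
theorem ObtainedByRemoving.sum_le [Fintype N] {W V : Walk (digraph A) i j} (hH : H ≤ crit A)
    (h : ObtainedByRemoving H W V R) : W.sum (nweight A) ≤ V.sum (nweight A) := by
  obtain ⟨hR, -, I, hI, hVW⟩ := h
  have h₁ := sum_add_of_edges_eq hVW (nweight A)
  have h₂ := crit_cycles_sum hH hI 0
  have h₃ := cycles_sum_le (f := nweight A) hR fun i c _ => sum_nweight_nonpos c
  simp only [Pi.zero_apply, sub_zero, add_zero] at h₂
  linarith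

/-- The lengths at which the cycle removal property holds. -/
def removalLengths (A : Matrix N N (WithBot ℝ)) (γ : ℕ) (H : DGraph N) : Set ℕ :=
  {T | ∀ i j (W : Walk (digraph A) i j), W.Visits H → T ≤ W.length →
    ∃ V : Walk (digraph A) i j, V.Visits H ∧ (∃ R, ObtainedByRemoving H W V R) ∧
      V.length ≡ W.length [MOD γ] ∧ V.length ≤ T}

/-- Insert into `W` a long detour through `H` whose edges are at least as heavy as those of `W`,
after a change of potential, and remove cycles. -/
theorem exists_removal_of_detour [Fintype N] (hH : H ≤ crit A) {γ τ t : ℕ} (hγ : 0 < γ)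
    (hτ : τ ∈ removalLengths A γ H) (hlt : τ < t + γ) (x : N → ℝ) {ν : ℝ} (hν : ν ≤ 0)
    {W : Walk (digraph A) i j} (hW : W.length = t)
    (hWν : ∀ e ∈ W.edges, nweight A e + (x e.2 - x e.1) ≤ ν) {k : N} (hk : k ∈ W.support)
    (D : Walk (digraph A) k k) (hD : 0 < D.length)
    (hDν : ∀ e ∈ D.edges, ν ≤ nweight A e + (x e.2 - x e.1)) (hDH : D.Visits H) :
    ∃ X : Walk (digraph A) i j, X.Visits H ∧ X.length ≡ t [MOD γ] ∧
      W.sum (nweight A) ≤ X.sum (nweight A) := by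
  obtain ⟨p, q, rfl⟩ := Walk.exists_append_of_mem_support hk
  -- The factor `γ` preserves the residue, and `τ + 1` makes the walk long enough for cycle removal.
  set D' := D.rep (γ * (τ + 1)) with hD'
  have hpos : 0 < γ * (τ + 1) := by positivity
  obtain ⟨h, hhD, hh⟩ := hDH
  have hvis : (p.append (D'.append q)).Visits H :=
    ⟨h, by simp [Walk.mem_support_append, hD', Walk.mem_support_rep hpos hhD], hh⟩
  have hlen : (p.append (D'.append q)).length = t + γ * ((τ + 1) * D.length) := by
    rw [Walk.length_append] at hW
    simp only [Walk.length_append, hD', Walk.length_rep, ← hW]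
    ring
  have hlong : τ ≤ (p.append (D'.append q)).length := by
    rw [hlen]
    have h₁ : (τ + 1) ≤ (τ + 1) * D.length := Nat.le_mul_of_pos_right _ hD
    have h₂ : (τ + 1) * D.length ≤ γ * ((τ + 1) * D.length) := Nat.le_mul_of_pos_left _ hγ
    omega
  obtain ⟨V, hV, ⟨R, hR, hRle, I, hI, hVW⟩, hmod, hVτ⟩ := hτ _ _ _ hvis hlong
  have hmod' : V.length ≡ t [MOD γ] := by
    refine hmod.trans ?_
    rw [hlen]
    exact (Nat.ModEq.refl t).add ((Nat.modEq_zero_iff_dvd).2 (Dvd.intro _ rfl))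
  -- A length congruent to `t` and less than `t + γ` is at most `t`.
  have hVt : V.length ≤ t := by
    by_contra! hcon
    obtain ⟨c, hc⟩ := (Nat.modEq_iff_dvd' hcon.le).1 hmod'.symm
    rcases Nat.eq_zero_or_pos c with rfl | hc0
    · omega
    · have : γ ≤ γ * c := Nat.le_mul_of_pos_right _ hc0
      omega
  refine ⟨V, hV, hmod', ?_⟩
  set f : N × N → ℝ := fun e => nweight A e + (x e.2 - x e.1) with hf
  have hfI : (I.sum.map f).sum = 0 := crit_cycles_sum hH hI x
  have hsplit : ∀ S : Multiset (N × N),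
      (S.map fun e => f e - ν).sum = (S.map f).sum - Multiset.card S * ν := by
    intro S
    simp [Multiset.sum_map_sub]
  have h₁ := sum_add_of_edges_eq hVW fun e => f e - ν
  rw [hsplit I.sum, hfI] at h₁
  -- Relative to the level `ν`, the edges of `p` and `q` count nonpositively and those of the detour
  -- nonnegatively. So whatever is removed carries at most the weight that the detour brought in.
  have h₂ : (R.sum.map fun e => f e - ν).sum ≤ D'.sum fun e => f e - ν := by
    have h₃ : (R.sum.map fun e => f e - ν).sum ≤ (R.sum.map fun e => max (f e - ν) 0).sum :=
      Multiset.sum_map_le_sum_map _ _ fun e _ => le_max_left _ _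
    refine h₃.trans ((multiset_sum_le_of_le hRle fun e => le_max_right _ _).trans ?_)
    rw [← Walk.sum_eq_multiset, Walk.sum_append, Walk.sum_append]
    have hzero : ∀ {a b : N} (w : Walk (digraph A) a b), (∀ e ∈ w.edges, f e ≤ ν) →
        w.sum (fun e => max (f e - ν) 0) = 0 := by
      intro a b w hw
      refine List.sum_eq_zero fun y hy => ?_
      obtain ⟨e, he, rfl⟩ := List.mem_map.1 hy
      exact max_eq_right (by linarith [hw e he])
    rw [hzero p fun e he => hWν e (by simp [he]), hzero q fun e he => hWν e (by simp [he])]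
    have : D'.sum (fun e => max (f e - ν) 0) = D'.sum fun e => f e - ν := by
      refine congrArg List.sum (List.map_congr_left fun e he => max_eq_left ?_)
      have := hDν e (Walk.mem_edges_of_mem_rep he)
      linarith
    linarith
  rw [Walk.sum_append, Walk.sum_append] at h₁
  simp only [Walk.sum_sub_const] at h₁ h₂
  have h₄ : V.sum f = _ := Walk.sum_add_potential (nweight A) x V
  have h₅ : (p.append q).sum f = _ := Walk.sum_add_potential (nweight A) x (p.append q)
  have h₆ : (p.length : ℝ) + q.length = t := by
    rw [← hW, Walk.length_append]; push_cast; ring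
  have h₇ : (V.length : ℝ) ≤ t := by exact_mod_cast hVt
  have h₈ : (0 : ℝ) ≤ Multiset.card I.sum := by positivity
  rw [Walk.sum_append] at h₅
  nlinarith [mul_nonneg (sub_nonneg.2 h₇) (neg_nonneg.2 hν), mul_nonneg h₈ (neg_nonneg.2 hν)]

end Removing

/-! ### Extending walks to a given length -/

section Upper

variable [Fintype N] {A : Matrix N N (WithBot ℝ)} {G K : DGraph N} {t : ℕ}

/-- Walks through `K` are dominated by walks of length `t`, if a walk visiting a component of `G`
can be shortened modulo `γ` and extended again to length `t`. -/
theorem exists_long_of_removal (hK : IsRepresenting A K) (hG : IsRepresenting A G)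
    {γ : DGraph N → ℕ} (hγ : ∀ H, DGraph.IsSCC H G → 0 < γ H ∧ H.cyclicity ∣ γ H)
    (hτ : ∀ H, DGraph.IsSCC H G → ∃ τ ∈ removalLengths A (γ H) H, ∀ h ∈ H.nodes,
      ∃ p, γ H ∣ p ∧ (∀ s, γ H ∣ s → p ≤ s → ∃ w : Walk (crit A) h h, w.length = s) ∧
        τ + 1 + p ≤ t + γ H)
    {i j : N} (X : Walk (digraph A) i j) (hX : X.Visits K) (hXt : X.length ≡ t [MOD K.cyclicity]) :
    ∃ Y : Walk (digraph A) i j, Y.length = t ∧ X.sum (nweight A) ≤ Y.sum (nweight A) := by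
  obtain ⟨k, hkX, hk⟩ := hX
  have hkc := hK.le_crit.1 hk
  have hC := isSCC_scc hkc
  obtain ⟨H, hH, hHC⟩ := exists_representative hG hC
  obtain ⟨h, hh⟩ := hH.prop.2.1
  obtain ⟨hγ₀, hHγ⟩ := hγ H hH
  have hdγ : (scc (crit A) k).closedWalkGcd ∣ γ H :=
    (closedWalkGcd_dvd_of_le hHC).trans ((closedWalkGcd_dvd_cyclicity (isSCC_self hH)).trans hHγ)
  obtain ⟨τ, hτ, hp⟩ := hτ H hH
  obtain ⟨Y, hYX, hhY, hYt, hYτ⟩ := exists_reroute hC X hkX (mem_scc_self hkc) (hHC.1 hh) hγ₀ hdγ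
    (hXt.of_dvd (closedWalkGcd_dvd_rep_cyclicity hK hC)) τ
  obtain ⟨V, ⟨v, hvV, hv⟩, ⟨R, hR⟩, hmod, hVτ⟩ := hτ _ _ Y ⟨h, hhY, hh⟩ hYτ
  obtain ⟨p, hpγ, hp, hpt⟩ := hp v hv
  have hmod' : V.length ≡ t [MOD γ H] := hmod.trans hYt
  -- Again a congruence: `p + V.length` is in the class of `t` modulo `γ H` and less than `t + γ H`.
  have hpV : p + V.length ≤ t := by
    by_contra! hcon
    have hmod₂ : t ≡ p + V.length [MOD γ H] := by
      simpa using (((Nat.modEq_zero_iff_dvd).2 hpγ).add hmod').symm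
    obtain ⟨c, hc⟩ := (Nat.modEq_iff_dvd' hcon.le).1 hmod₂
    rcases Nat.eq_zero_or_pos c with rfl | hc0
    · omega
    · have : γ H ≤ γ H * c := Nat.le_mul_of_pos_right _ hc0
      omega
  have hdvd : γ H ∣ t - V.length := (Nat.modEq_iff_dvd' (by omega)).1 hmod'
  obtain ⟨w, hw⟩ := hp (t - V.length) hdvd (by omega)
  obtain ⟨w', hw'⟩ := w.exists_map (crit_le_digraph A)
  obtain ⟨a, b, rfl⟩ := Walk.exists_append_of_mem_support hvV
  refine ⟨a.append (w'.append b), ?_, ?_⟩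
  · simp only [Walk.length_append, Walk.length_eq_of_edges hw', hw] at hpV ⊢
    omega
  · have h₁ := hR.sum_le (hH.prop.1.trans hG.le_crit)
    have h₂ : w'.sum (nweight A) = 0 := by rw [Walk.sum_eq_of_edges hw', crit_closed_sum]
    rw [Walk.sum_append] at h₁
    simp only [Walk.sum_append, h₂]
    linarith

end Upper

/-! ### Threshold graphs -/

section Threshold

variable {A : Matrix N N (WithBot ℝ)} {thr : ℝ → DGraph N} {m : ℝ} {a k : N}

theorem splitLevels_le {μ : ℝ} (h : μ ∈ splitLevels A thr) : μ ≤ maxCycleMean A := h.1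

theorem exists_crit_of_not_mem_splitLevels (hm : m ≤ maxCycleMean A) (h : m ∉ splitLevels A thr)
    (ha : a ∈ (thr m).nodes) : ∃ c ∈ (crit A).nodes, c ∈ (scc (thr m) a).nodes := by
  by_contra! hcon
  refine h ⟨hm, _, isSCC_scc ha, ?_⟩
  rintro ⟨C, hC, hle⟩
  obtain ⟨c, hc⟩ := hC.prop.2.1
  exact hcon c (hC.prop.1.1 hc) (hle.1 hc)

theorem exists_crit_of_mem_sccUnion {D : DGraph N} (hk : k ∈ (D.sccUnion (crit A)).nodes) :
    ∃ c ∈ (crit A).nodes, c ∈ (scc D k).nodes := by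
  obtain ⟨F, hF, ⟨c, hcF, hc⟩, hkF⟩ := hk
  exact ⟨c, hc, IsSCC.eq_scc hF hkF ▸ hcF⟩

/-- Above the split levels, each component of the threshold graph meets the critical graph; at
the greatest one, this holds for the components that define the scheme. -/
theorem exists_threshold_level (hm : m ≤ maxCycleMean A) (ha : a ∈ (thr m).nodes)
    (hk : k ∈ ((thresholdGraph A thr).sccUnion (crit A)).nodes) :
    ∃ μ ≤ maxCycleMean A, m ≤ μ ∧ ∃ b, (b = a ∨ b = k) ∧
      ∃ c ∈ (crit A).nodes, c ∈ (scc (thr μ) b).nodes := by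
  -- Up to the supremum of the split levels, that supremum serves with `b = k`, by the definition of
  -- the scheme. Otherwise `m` is not a split level and serves itself with `b = a`. Whether the
  -- supremum is attained plays no role.
  by_cases hs : m ∈ splitLevels A thr ∨
      (splitLevels A thr).Nonempty ∧ m ≤ sSup (splitLevels A thr)
  · have hne : (splitLevels A thr).Nonempty := hs.elim (fun h => ⟨m, h⟩) And.left
    have hle : m ≤ sSup (splitLevels A thr) :=
      hs.elim (fun h => le_csSup ⟨_, fun _ h => splitLevels_le h⟩ h) And.right
    rw [thresholdGraph, if_pos hne] at hk
    exact ⟨_, csSup_le hne fun _ h => splitLevels_le h, hle, k, Or.inr rfl,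
      exists_crit_of_mem_sccUnion hk⟩
  · exact ⟨m, hm, le_rfl, a, Or.inl rfl,
      exists_crit_of_not_mem_splitLevels hm (fun h => hs (Or.inl h)) ha⟩

end Threshold

/-! ### The schemes of Nachtigall and of Hartmann and Arguelles -/

section Schemes

variable {A V : Matrix N N (WithBot ℝ)} {G K : DGraph N} {γ : DGraph N → ℕ} {T t : ℕ}

/-- A finite bound forces both summands to be finite, hence attained. Writing `γ` on the right
removes the truncated subtraction, of which only `τ₀ + 1 ≤ (τ₀ + 1 - γ) + γ` is used. -/
theorem exists_of_bound_le {A : Matrix N N (WithBot ℝ)} {H : DGraph N} {γ T t : ℕ}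
    (hT : (Tcr A γ H + 1 - γ) + ep A γ H ≤ T) (ht : T ≤ t) :
    ∃ τ ∈ removalLengths A γ H, ∀ h ∈ H.nodes,
      ∃ p, γ ∣ p ∧ (∀ s, γ ∣ s → p ≤ s → ∃ w : Walk (crit A) h h, w.length = s) ∧
        τ + 1 + p ≤ t + γ := by
  obtain ⟨τ₀, hτ₀⟩ : ∃ τ₀ : ℕ, Tcr A γ H = τ₀ := by
    refine ⟨(Tcr A γ H).toNat, (ENat.natCast_toNat fun h => ?_).symm⟩
    rw [h] at hT
    simp at hT
  obtain ⟨e, he⟩ : ∃ e : ℕ, ep A γ H = e := by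
    refine ⟨(ep A γ H).toNat, (ENat.natCast_toNat fun h => ?_).symm⟩
    rw [h] at hT
    simp at hT
  obtain ⟨τ, hτ, hle⟩ := exists_mem_le_of_leastNat_le hτ₀.le
  refine ⟨τ, hτ, fun h hh => ?_⟩
  have hep : epNode A γ h ≤ e := he ▸ le_iSup₂ (f := fun i (_ : i ∈ H.nodes) => epNode A γ i) h hh
  obtain ⟨p, ⟨hp₁, hp₂⟩, hpe⟩ := exists_mem_le_of_leastNat_le hep
  refine ⟨p, hp₁, hp₂, ?_⟩
  rw [hτ₀, he] at hT
  have : τ₀ + 1 - γ + e ≤ T := by exact_mod_cast hT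
  omega

theorem scale_potential_of_adj {x : N → ℝ}
    (hx : ∀ i j, V i j = A i j + ((x j - x i : ℝ) : WithBot ℝ)) {a b : N}
    (h : (digraph A).Adj a b) :
    V a b = ((nweight A (a, b) + (x b - x a) + maxCycleMean A : ℝ) : WithBot ℝ) := by
  rw [hx, ← coe_unbotD_of_adj h, ← WithBot.coe_add, nweight]
  congr 1
  ring

theorem thrHA_le_digraph {x : N → ℝ}
    (hx : ∀ i j, V i j = A i j + ((x j - x i : ℝ) : WithBot ℝ)) (μ : ℝ) :
    thrHA V μ ≤ digraph A := by
  refine ⟨fun _ _ => Set.mem_univ _, fun a b (hab : (μ : WithBot ℝ) ≤ V a b) h => ?_⟩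
  rw [hx, h, WithBot.bot_add] at hab
  simp at hab

theorem crit_le_thrHA (hV : IsMaxBalancing A V) {μ : ℝ} (hμ : μ ≤ maxCycleMean A) :
    crit A ≤ thrHA V μ := by
  have h : ∀ a b, (crit A).Adj a b → (thrHA V μ).Adj a b := fun a b hab => by
    change (μ : WithBot ℝ) ≤ V a b
    rw [hV.eq_of_crit a b hab]
    exact_mod_cast hμ
  exact ⟨fun a ⟨b, hab⟩ => hab.elim (fun hab => (thrHA V μ).left_mem (h a b hab))
    fun hab => (thrHA V μ).right_mem (h b a hab), h⟩

/-- Let `e₀` be an edge of `W` of greatest balanced weight. `exists_threshold_level` yields a level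
at least this weight and a node of `W` whose component at that level contains a critical node. A
round trip to it uses only edges no lighter than those of `W`. -/
theorem exists_dominating_HA [Fintype N] (hG : IsRepresenting A G)
    (hγ : ∀ H, DGraph.IsSCC H G → 0 < γ H ∧ H.cyclicity ∣ γ H)
    (hτ : ∀ H, DGraph.IsSCC H G → ∃ τ ∈ removalLengths A (γ H) H, τ < t + γ H)
    (hV : IsMaxBalancing A V) (ht : 0 < t) {i j : N} (W : Walk (digraph A) i j)
    (hW : W.length = t) (hWE : W.Visits (graphHA A V)) :
    ∃ X : Walk (digraph A) i j, ∃ C, DGraph.IsSCC C (crit A) ∧ X.Visits C ∧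
      X.length ≡ t [MOD C.closedWalkGcd] ∧ W.sum (nweight A) ≤ X.sum (nweight A) := by
  obtain ⟨x, hx⟩ := hV.scaling
  obtain ⟨k, hkW, hk⟩ := hWE
  set f : N × N → ℝ := fun e => nweight A e + (x e.2 - x e.1)
  obtain ⟨e₀, he₀, hmax⟩ := Set.exists_max_image {e | e ∈ W.edges} f (List.finite_toSet _) <| by
    rw [Walk.length_eq] at hW
    exact List.exists_mem_of_length_pos (hW ▸ ht)
  have hVe : ∀ {a b : N}, (digraph A).Adj a b →
      V a b = ((f (a, b) + maxCycleMean A : ℝ) : WithBot ℝ) := scale_potential_of_adj hx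
  have hm : f e₀ + maxCycleMean A ≤ maxCycleMean A := by
    have := hV.le e₀.1 e₀.2
    rw [hVe (Walk.adj_of_mem_edges he₀)] at this
    exact_mod_cast this
  have ha : (thrHA V (f e₀ + maxCycleMean A)).Adj e₀.1 e₀.2 :=
    (hVe (Walk.adj_of_mem_edges he₀)).ge
  obtain ⟨μ, hμ, hmμ, b, hb, c, hc, hcb⟩ :=
    exists_threshold_level (thr := thrHA V) hm ((thrHA V _).left_mem ha) hk
  have hbW : b ∈ W.support := by
    rcases hb with rfl | rfl
    · exact (Walk.mem_support_of_mem_edges he₀).1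
    · exact hkW
  have hC := isSCC_scc hc
  obtain ⟨H, hH, hHC⟩ := exists_representative hG hC
  obtain ⟨h, hh⟩ := hH.prop.2.1
  obtain ⟨hγ₀, hHγ⟩ := hγ H hH
  obtain ⟨τ, hτ, hlt⟩ := hτ H hH
  obtain ⟨⟨u⟩, ⟨v⟩⟩ := hcb
  obtain ⟨⟨y⟩, ⟨z⟩⟩ := hHC.1 hh
  -- The connecting walks may all be empty; `s` makes the detour nonempty.
  obtain ⟨s, hs⟩ := crit_exists_closed hc
  obtain ⟨D₁, hD₁⟩ := (s.append (y.append z)).exists_map (crit_le_thrHA hV hμ)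
  obtain ⟨D, hD⟩ := (u.append (D₁.append v)).exists_map (thrHA_le_digraph hx μ)
  have hDlen : 0 < D.length := by
    rw [Walk.length_eq_of_edges hD, Walk.length_append, Walk.length_append,
      Walk.length_eq_of_edges hD₁, Walk.length_append]
    omega
  have hDν : ∀ e ∈ D.edges, μ - maxCycleMean A ≤ f e := fun e he => by
    have h₁ : (μ : WithBot ℝ) ≤ V e.1 e.2 := Walk.adj_of_mem_edges (hD ▸ he)
    rw [hVe (Walk.adj_of_mem_edges he), WithBot.coe_le_coe] at h₁
    linarith
  have hDh : h ∈ D.support := by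
    rw [Walk.support_eq_of_edges hD]
    simp only [Walk.mem_support_append, Walk.support_eq_of_edges hD₁]
    exact Or.inr (Or.inl (Or.inr (Or.inl y.end_mem_support)))
  obtain ⟨X, hX, hXt, hWX⟩ := exists_removal_of_detour (hH.prop.1.trans hG.le_crit) hγ₀ hτ hlt x
    (ν := μ - maxCycleMean A) (by linarith) hW (fun e he => by
      have := hmax e he
      change f e ≤ _
      linarith) hbW D hDlen hDν ⟨h, hDh, hh⟩
  refine ⟨X, _, hC, visits_of_le hX hHC, hXt.of_dvd ?_, hWX⟩
  exact (closedWalkGcd_dvd_of_le hHC).trans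
    ((closedWalkGcd_dvd_cyclicity (isSCC_self hH)).trans hHγ)

variable [Fintype N] [DecidableEq N]

theorem T₁_nachtigall_and_hartmannArguelles_le (hK : IsRepresenting A K)
    (hG : IsRepresenting A G)
    (hγ : ∀ H, DGraph.IsSCC H G → 0 < γ H ∧ H.cyclicity ∣ γ H)
    (hT : ∀ H, DGraph.IsSCC H G → (Tcr A (γ H) H + 1 - γ H) + ep A (γ H) H ≤ T) :
    T₁ A K (nachtigall A) ≤ T ∧
      ∀ V, IsMaxBalancing A V → T₁ A K (hartmannArguelles A V) ≤ T := by
  refine ⟨leastNat_le fun t ht => ?_, fun V hV => leastNat_le fun t ht => ?_⟩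
  · refine weakCSRAt_cancel hK _ (fun i j X hX hXt => exists_long_of_removal hK hG hγ
      (fun H hH => exists_of_bound_le (hT H hH) ht) X hX hXt) ?_
    rintro - i j W hW ⟨k, hkW, hk⟩
    -- Here `E` is the critical graph, so `W` itself is counted by the CSR term.
    exact ⟨W, _, isSCC_scc hk, ⟨k, hkW, mem_scc_self hk⟩, by rw [hW], le_rfl⟩
  · refine weakCSRAt_cancel hK _ (fun i j X hX hXt => exists_long_of_removal hK hG hγ
      (fun H hH => exists_of_bound_le (hT H hH) ht) X hX hXt) ?_
    refine fun ht₀ i j W hW hWE => exists_dominating_HA hG hγ (fun H hH => ?_) hV ht₀ W hW hWE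
    obtain ⟨τ, hτ, hp⟩ := exists_of_bound_le (hT H hH) ht
    obtain ⟨h, hh⟩ := hH.prop.2.1
    obtain ⟨p, -, -, hp⟩ := hp h hh
    exact ⟨τ, hτ, by omega⟩

end Schemes

/-! ### The graph of a cycle -/

namespace Walk

variable {G G' : DGraph N} {i j k : N}

theorem isCycle_of_edges {c : Walk G i i} {c' : Walk G' i i} (h : c'.edges = c.edges)
    (hc : c.IsCycle) : c'.IsCycle := by
  rw [IsCycle, length_eq_of_edges h, support_eq_of_edges h]
  exact hc

theorem toGraph_of_edges {c : Walk G i i} {c' : Walk G' i i} (h : c'.edges = c.edges) :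
    c'.toGraph = c.toGraph := by
  simp [toGraph, h]

theorem end_mem_map_snd {i j : N} {w : Walk G i j} (hw : 0 < w.length) :
    j ∈ w.edges.map Prod.snd := by
  induction w with
  | nil => simp [length] at hw
  | cons h w ih =>
    cases w with
    | nil => simp [edges]
    | cons h' w =>
      have := ih (by simp [length])
      rw [edges, List.map_cons]
      exact List.mem_cons_of_mem _ this

theorem mem_map_snd_of_mem_support {c : Walk G i i} (hc : 0 < c.length) (hk : k ∈ c.support) :
    k ∈ c.edges.map Prod.snd := by
  rw [support_eq] at hk
  rcases List.mem_cons.1 hk with rfl | hk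
  · exact end_mem_map_snd hc
  · exact hk

theorem mem_toGraph_nodes {c : Walk G i i} (hc : 0 < c.length) :
    k ∈ c.toGraph.nodes ↔ k ∈ c.support := by
  constructor
  · rintro ⟨j, h | h⟩
    · exact (mem_support_of_mem_edges h).1
    · exact (mem_support_of_mem_edges h).2
  · intro hk
    obtain ⟨e, he, rfl⟩ := List.mem_map.1 (mem_map_snd_of_mem_support hc hk)
    exact c.toGraph.right_mem (i := e.1) he

theorem IsCycle.nodup_map_snd {c : Walk G i i} (hc : c.IsCycle) :
    (c.edges.map Prod.snd).Nodup := by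
  have := hc.2
  rwa [support_eq, List.tail_cons] at this

/-- A cycle is the only cycle of its graph, up to the choice of the start. -/
theorem IsCycle.edges_eq_of_isCycleEdges {z : Walk G i i} (hz : z.IsCycle)
    {E : Multiset (N × N)} (hE : IsCycleEdges z.toGraph E) : E = (z.edges : Multiset (N × N)) := by
  obtain ⟨k, c, hc, rfl⟩ := hE
  have hcz : ∀ e ∈ c.edges, e ∈ z.edges := fun e he => adj_of_mem_edges he
  -- Heads do not repeat in `z`, so each node has a single incoming edge in `z`. For a node of `c`
  -- this must be the edge by which `c` enters it.
  have hback : ∀ a b, (a, b) ∈ z.edges → b ∈ c.support → (a, b) ∈ c.edges ∧ a ∈ c.support := by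
    intro a b hab hb
    obtain ⟨e, he, rfl⟩ := List.mem_map.1 (mem_map_snd_of_mem_support hc.1 hb)
    have : (a, e.2) = e := List.inj_on_of_nodup_map hz.nodup_map_snd hab (hcz e he) rfl
    rw [this]
    refine ⟨he, ?_⟩
    have h₁ : a = e.1 := congrArg Prod.fst this
    rw [h₁]
    exact (mem_support_of_mem_edges he).1
  have hwalk : ∀ {x y : N} (w : Walk G x y), (∀ e ∈ w.edges, e ∈ z.edges) → y ∈ c.support →
      x ∈ c.support ∧ ∀ e ∈ w.edges, e ∈ c.edges := by
    intro x y w hw hy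
    induction w with
    | nil => exact ⟨hy, by simp [edges]⟩
    | cons h w ih =>
      obtain ⟨h₁, h₂⟩ := ih (fun e he => hw e (List.mem_cons_of_mem _ he)) hy
      obtain ⟨h₃, h₄⟩ := hback _ _ (hw _ List.mem_cons_self) h₁
      refine ⟨h₄, fun e he => ?_⟩
      rcases List.mem_cons.1 he with rfl | he
      · exact h₃
      · exact h₂ e he
  have hkz : k ∈ z.support := by
    rw [← mem_toGraph_nodes hz.1]
    exact c.start_mem
  -- Going back along `z` from `k` shows that its start is on `c`; going back along all of `z` then
  -- puts every edge in `c`.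
  obtain ⟨p, q, hpq⟩ := exists_append_of_mem_support hkz
  have hi := (hwalk p (fun e he => by rw [hpq, edges_append]; simp [he]) c.start_mem_support).1
  have hzc := (hwalk z (fun e he => he) hi).2
  exact Multiset.coe_eq_coe.2 ((List.perm_ext_iff_of_nodup (List.Nodup.of_map _ hc.nodup_map_snd)
    (List.Nodup.of_map _ hz.nodup_map_snd)).2 fun e => ⟨hcz e, hzc e⟩)

/-- A walk through a closed walk `z` can be extended by copies of `z`. -/
theorem exists_insert_closed {z : Walk G k k} {V : Walk G i j} (hz : 0 < z.length)
    (hV : V.Visits z.toGraph) (m : ℕ) :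
    ∃ V' : Walk G i j, V'.length = V.length + m * z.length ∧
      (∀ f, V'.sum f = V.sum f + m * z.sum f) ∧ (∀ x ∈ V.support, x ∈ V'.support) ∧
      (0 < m → ∀ x ∈ z.support, x ∈ V'.support) := by
  obtain ⟨v, hvV, hv⟩ := hV
  rw [mem_toGraph_nodes hz] at hv
  obtain ⟨a, b, rfl⟩ := exists_append_of_mem_support hv
  obtain ⟨p, q, rfl⟩ := exists_append_of_mem_support hvV
  refine ⟨p.append (((b.append a).rep m).append q), ?_, fun f => ?_, fun x hx => ?_,
    fun hm x hx => ?_⟩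
  · simp; ring
  · simp; ring
  · simp only [mem_support_append] at hx ⊢
    tauto
  · refine mem_support_append.2 (Or.inr (mem_support_append.2 (Or.inl (mem_support_rep hm ?_))))
    rw [mem_support_append] at hx ⊢
    exact hx.symm

end Walk

theorem mem_scc_of_closed {G : DGraph N} {i k a : N} {c : Walk G i i} (hk : k ∈ c.support)
    (ha : a ∈ c.support) : a ∈ (scc G k).nodes := by
  obtain ⟨p, q, -⟩ := Walk.exists_append_of_mem_support hk
  obtain ⟨p', q', -⟩ := Walk.exists_append_of_mem_support ha
  exact ⟨⟨q.append p'⟩, ⟨q'.append p⟩⟩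

theorem scc_mono {G G' : DGraph N} (h : G ≤ G') {k a : N} (ha : a ∈ (scc G k).nodes) :
    a ∈ (scc G' k).nodes :=
  ⟨⟨(ha.1.some.exists_map h).choose⟩, ⟨(ha.2.some.exists_map h).choose⟩⟩

/-! ### The cycle threshold scheme -/

section CycleThreshold

variable {A : Matrix N N (WithBot ℝ)} {K : DGraph N} {T t : ℕ}

/-- The lengths at which the strict cycle removal property holds. -/
def strictRemovalLengths (A : Matrix N N (WithBot ℝ)) (γ : ℕ) (H : DGraph N) : Set ℕ :=
  {T | ∀ i j (W : Walk (digraph A) i j), W.Visits H → T ≤ W.length →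
    ∃ V : Walk (digraph A) i j, V.Visits H ∧ (∃ R, R ≠ 0 ∧ ObtainedByRemoving H W V R) ∧
      V.length ≡ W.length [MOD γ] ∧ V.length ≤ T}

theorem exists_mul_add_of_modEq {a b n : ℕ} (h : a ≡ b [MOD n]) (hab : a ≤ b) :
    ∃ m, a + m * n = b := by
  obtain ⟨m, hm⟩ := (Nat.modEq_iff_dvd' hab).1 h
  exact ⟨m, by rw [mul_comm, ← hm]; omega⟩

theorem sum_eq_mean_mul {i : N} {c : Walk (digraph A) i i} (hc : 0 < c.length) :
    c.sum (nweight A) = (c.mean A - maxCycleMean A) * c.length := by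
  have : (0 : ℝ) < c.length := by exact_mod_cast hc
  rw [sum_nweight, Walk.mean, sub_mul, div_mul_cancel₀ _ this.ne', mul_comm (maxCycleMean A)]

/-- Replacing cycles of a walk by copies of a cycle `Z`: either the weight does not decrease and
the new walk runs through `Z`, or some cycle of the walk has a greater mean than `Z`. -/
theorem exists_replace_cycles {k : N} {Z : Walk (digraph A) k k} (hZ : Z.IsCycle) {τ : ℕ}
    (hτ : τ ∈ strictRemovalLengths A Z.length Z.toGraph) (hτt : τ ≤ t) {i j : N}
    (W : Walk (digraph A) i j) (hW : W.length = t) (hWZ : W.Visits Z.toGraph) :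
    (∃ l, ∃ c : Walk (digraph A) l l, c.IsCycle ∧ (∀ e ∈ c.edges, e ∈ W.edges) ∧
      Z.mean A < c.mean A) ∨
    ∃ V : Walk (digraph A) i j, V.length = t ∧ W.sum (nweight A) ≤ V.sum (nweight A) ∧
      ∀ x ∈ Z.support, x ∈ V.support := by
  obtain ⟨V, hV, ⟨R, hR₀, hR, hRW, I, hI, hVW⟩, hmod, hVτ⟩ := hτ i j W hWZ (hW ▸ hτt)
  rw [or_iff_not_imp_left]
  intro hcon
  push Not at hcon
  rw [hW] at hmod
  obtain ⟨m, hm⟩ := exists_mul_add_of_modEq hmod (hVτ.trans hτt)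
  obtain ⟨V', hV'len, hV'sum, hV'V, hV'Z⟩ := Walk.exists_insert_closed hZ.1 hV m
  -- Only copies of `Z` can be inserted. Relative to the mean `ρ` of `Z` they weigh 0, and the
  -- removed cycles, of mean at most that of `Z`, weigh at most 0.
  have hIE : ∀ E ∈ I, E = (Z.edges : Multiset (N × N)) := fun E hE =>
    hZ.edges_eq_of_isCycleEdges (hI E hE)
  set ρ := Z.mean A - maxCycleMean A with hρ
  have hZsum : Z.sum (nweight A) = ρ * Z.length := sum_eq_mean_mul hZ.1
  have hIsum : (I.sum.map fun e => nweight A e - ρ).sum = 0 :=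
    multiset_sum_map_eq_zero fun E hE => by
      rw [hIE E hE, ← Walk.sum_eq_multiset, Walk.sum_sub_const, hZsum]
      ring
  have hRsum : (R.sum.map fun e => nweight A e - ρ).sum ≤ 0 :=
    multiset_sum_map_nonpos fun E hE => by
      obtain ⟨l, c, hc, rfl⟩ := hR E hE
      have hle : (c.edges : Multiset (N × N)) ≤ W.edges :=
        (Multiset.le_sum_of_mem hE).trans hRW
      have := hcon l c hc fun e he => Multiset.mem_of_le hle he
      rw [← Walk.sum_eq_multiset, Walk.sum_sub_const, sum_eq_mean_mul hc.1]
      have h₀ : (0 : ℝ) ≤ c.length := Nat.cast_nonneg _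
      have h₁ : c.mean A - maxCycleMean A ≤ ρ := by rw [hρ]; linarith
      nlinarith
  have h₁ := sum_add_of_edges_eq hVW fun e => nweight A e - ρ
  rw [hIsum, Walk.sum_sub_const, Walk.sum_sub_const, hW] at h₁
  have hm' : (V.length : ℝ) + m * Z.length = t := by exact_mod_cast hm
  refine ⟨V', hV'len.trans hm, ?_, fun x hx => ?_⟩
  · have h₂ : m * (ρ * Z.length) = ρ * t - ρ * V.length := by rw [← hm']; ring
    rw [hV'sum, hZsum, h₂]
    linarith
  -- Strictness of the removal is needed here. If no copy of `Z` is appended, `V` is as long as `W`;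
  -- since something was removed, something was inserted, so `V` already contains the edges of `Z`.
  · rcases Nat.eq_zero_or_pos m with rfl | hm₀
    · have hcard := congrArg Multiset.card hVW
      rw [Multiset.card_add, Multiset.card_add, Multiset.coe_card, Multiset.coe_card,
        ← Walk.length_eq, ← Walk.length_eq, hW] at hcard
      have hRpos : 0 < Multiset.card R.sum := by
        obtain ⟨E, hE⟩ := Multiset.exists_mem_of_ne_zero hR₀
        obtain ⟨l, c, hc, rfl⟩ := hR E hE
        have := Multiset.card_le_card (Multiset.le_sum_of_mem hE)
        rw [Multiset.coe_card, ← Walk.length_eq] at this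
        exact hc.1.trans_le this
      have hI₀ : I ≠ 0 := by
        rintro rfl
        simp at hcard
        omega
      obtain ⟨E, hE⟩ := Multiset.exists_mem_of_ne_zero hI₀
      have hEV : (Z.edges : Multiset (N × N)) ≤ V.edges := by
        obtain ⟨U, hU⟩ := Multiset.le_iff_exists_add.1 hRW
        have h₂ : (V.edges : Multiset (N × N)) = U + I.sum := by
          rw [hU, add_comm, add_assoc] at hVW
          exact add_left_cancel hVW
        rw [h₂, ← hIE E hE]
        exact (Multiset.le_sum_of_mem hE).trans (Multiset.le_add_left _ _)
      refine hV'V x ?_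
      obtain ⟨e, he, rfl⟩ := List.mem_map.1 (Walk.mem_map_snd_of_mem_support hZ.1 hx)
      exact (Walk.mem_support_of_mem_edges (Multiset.mem_of_le hEV he)).2
    · exact hV'Z hm₀ x hx

theorem mem_thresholdGraph_of_mean {i : N} {Z : Walk (digraph A) i i} (hZ : Z.IsCycle)
    (hs : ∀ s ∈ splitLevels A (thrCT A), s ≤ Z.mean A) {e : N × N} (he : e ∈ Z.edges) :
    (thresholdGraph A (thrCT A)).Adj e.1 e.2 := by
  rw [thresholdGraph]
  split_ifs with hne
  · exact ⟨i, Z, hZ, csSup_le hne hs, he⟩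
  · exact Walk.adj_of_mem_edges he

theorem thrCT_le_thresholdGraph {μ : ℝ} (hs : ∀ s ∈ splitLevels A (thrCT A), s ≤ μ) :
    thrCT A μ ≤ thresholdGraph A (thrCT A) := by
  have h : ∀ a b, (thrCT A μ).Adj a b → (thresholdGraph A (thrCT A)).Adj a b :=
    fun a b ⟨_, _, hc, hμ, he⟩ => mem_thresholdGraph_of_mean hc (fun s h => (hs s h).trans hμ) he
  exact ⟨fun a ⟨b, hab⟩ => hab.elim (fun hab => (thresholdGraph A _).left_mem (h a b hab))
    fun hab => (thresholdGraph A _).right_mem (h b a hab), h⟩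

/-- A cycle of the threshold graph whose component meets the critical graph is a cycle of the
graph that defines the scheme. -/
theorem exists_walk_graphCT {i k c : N} {Z : Walk (digraph A) i i} (hZ : Z.IsCycle)
    (hs : ∀ s ∈ splitLevels A (thrCT A), s ≤ Z.mean A) (hk : k ∈ Z.support)
    (hc : c ∈ (crit A).nodes) (hck : c ∈ (scc (thresholdGraph A (thrCT A)) k).nodes) :
    ∃ Z' : Walk (graphCT A) i i, Z'.edges = Z.edges := by
  set D := thresholdGraph A (thrCT A) with hD
  have hadj : ∀ e ∈ Z.edges, D.Adj e.1 e.2 := fun e he => mem_thresholdGraph_of_mean hZ hs he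
  have hDnodes : ∀ x ∈ Z.support, x ∈ D.nodes := fun x hx => by
    obtain ⟨e, he, rfl⟩ := List.mem_map.1 (Walk.mem_map_snd_of_mem_support hZ.1 hx)
    exact D.right_mem (hadj e he)
  obtain ⟨Z₁, hZ₁⟩ := Z.exists_transfer (hDnodes i Z.start_mem_support) hadj
  have hscc : ∀ x ∈ Z.support, x ∈ (scc D k).nodes := fun x hx =>
    mem_scc_of_closed (c := Z₁) (by rwa [Walk.support_eq_of_edges hZ₁])
      (by rwa [Walk.support_eq_of_edges hZ₁])
  have hF := isSCC_scc (hDnodes k hk)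
  exact Z.exists_transfer ⟨_, hF, ⟨c, hck, hc⟩, hscc i Z.start_mem_support⟩ fun e he =>
    ⟨_, hF, ⟨c, hck, hc⟩, hadj e he, hscc _ (Walk.mem_support_of_mem_edges he).1,
      hscc _ (Walk.mem_support_of_mem_edges he).2⟩

/-- The mean depends only on the edge list, and a cycle has at most as many edges as there are
nodes. -/
theorem finite_cycle_means [Finite N] (A : Matrix N N (WithBot ℝ)) :
    {x | ∃ i, ∃ c : Walk (digraph A) i i, c.IsCycle ∧ c.mean A = x}.Finite := by
  classical
  have := Fintype.ofFinite N
  refine ((List.finite_length_le (N × N) (Fintype.card N)).image fun l : List (N × N) =>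
    (l.map fun e => (A e.1 e.2).unbotD 0).sum / (l.length : ℝ)).subset ?_
  rintro _ ⟨i, c, hc, rfl⟩
  refine ⟨c.edges, ?_, ?_⟩
  · have := (hc.nodup_map_snd).length_le_card
    simpa using this
  · simp only [Walk.mean, Walk.weight, Walk.length_eq]

/-- A walk through a component of the graph of the scheme is dominated by a walk of the same
length through the critical graph. -/
theorem exists_visits_crit [Fintype N]
    (hτ : ∀ i, ∀ Z : Walk (graphCT A) i i, Z.IsCycle →
      ∃ τ ∈ strictRemovalLengths A Z.length Z.toGraph, τ ≤ t) {μ : ℝ}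
    (hs : ∀ s ∈ splitLevels A (thrCT A), s ≤ μ) {i j k c : N} (W : Walk (digraph A) i j)
    (hW : W.length = t) (hk : k ∈ W.support) (hc : c ∈ (crit A).nodes)
    (hck : c ∈ (scc (thrCT A μ) k).nodes) :
    ∃ X : Walk (digraph A) i j, X.length = t ∧ X.Visits (crit A) ∧
      W.sum (nweight A) ≤ X.sum (nweight A) := by
  -- The outer induction is on the number of cycle means above `μ`; the inner one follows a walk in
  -- the threshold graph from `k` to the critical node `c`.
  induction hn : {x | μ < x ∧ ∃ i, ∃ c : Walk (digraph A) i i, c.IsCycle ∧ c.mean A = x}.ncard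
    using Nat.strong_induction_on generalizing μ i j k c W with
  | _ n ih =>
  subst hn
  obtain ⟨⟨u⟩, ⟨v⟩⟩ := hck
  induction u generalizing W with
  | nil => exact ⟨W, hW, ⟨_, hk, hc⟩, le_rfl⟩
  | @cons k k' c h u ihu =>
    obtain ⟨z₀, Z, hZ, hμZ, hkZ⟩ := h
    have hsZ : ∀ s ∈ splitLevels A (thrCT A), s ≤ Z.mean A := fun s h => (hs s h).trans hμZ
    have hadj : (thrCT A μ).Adj k k' := ⟨z₀, Z, hZ, hμZ, hkZ⟩
    obtain ⟨Z', hZ'⟩ := exists_walk_graphCT hZ hsZ (Walk.mem_support_of_mem_edges hkZ).1 hc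
      (scc_mono (thrCT_le_thresholdGraph hs) ⟨⟨.cons hadj u⟩, ⟨v⟩⟩)
    obtain ⟨τ, hτ', hτt⟩ := hτ z₀ Z' (Walk.isCycle_of_edges hZ' hZ)
    rw [Walk.length_eq_of_edges hZ', Walk.toGraph_of_edges hZ'] at hτ'
    have hWZ : W.Visits Z.toGraph := ⟨k, hk, _, Or.inl hkZ⟩
    rcases exists_replace_cycles hZ hτ' hτt W hW hWZ with ⟨l, R, hR, hRW, hlt⟩ | ⟨V, hV, hWV, hZV⟩
    -- The mean of `R` exceeds all split levels, so the component of `R` at that level contains a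
    -- critical node. The outer induction applies to the same `W`.
    · have hlt' : μ < R.mean A := hμZ.trans_lt hlt
      obtain ⟨e, he⟩ := List.exists_mem_of_length_pos (R.length_eq ▸ hR.1)
      have he' : (thrCT A (R.mean A)).Adj e.1 e.2 := ⟨l, R, hR, le_rfl, he⟩
      obtain ⟨d, hd, hdR⟩ := exists_crit_of_not_mem_splitLevels (mean_le_maxCycleMean hR)
        (fun h => (hs _ h).not_gt hlt') ((thrCT A (R.mean A)).left_mem he')
      refine ih _ (Set.ncard_lt_ncard ?_ ((finite_cycle_means A).subset fun x hx => hx.2))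
        (fun s h => (hs s h).trans hlt'.le) W hW (Walk.mem_support_of_mem_edges (hRW e he)).1
        hd hdR rfl
      exact ⟨fun x hx => ⟨hlt'.trans hx.1, hx.2⟩,
        fun h => lt_irrefl _ (h ⟨hlt', l, R, hR, rfl⟩).1⟩
    -- The new walk passes through all of `Z`, in particular through `k'`, one edge closer to `c`.
    · obtain ⟨X, hX, hXc, hVX⟩ := ihu V hV (hZV k' (Walk.mem_support_of_mem_edges hkZ).2) hc
        (v.append (.cons hadj (.nil _ u.start_mem)))
      exact ⟨X, hX, hXc, hWV.trans hVX⟩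

theorem exists_visits_crit_of_visits [Fintype N]
    (hτ : ∀ i, ∀ Z : Walk (graphCT A) i i, Z.IsCycle →
      ∃ τ ∈ strictRemovalLengths A Z.length Z.toGraph, τ ≤ t) {i j : N} (W : Walk (digraph A) i j)
    (hW : W.length = t) (hWE : W.Visits (graphCT A)) :
    ∃ X : Walk (digraph A) i j, X.length = t ∧ X.Visits (crit A) ∧
      W.sum (nweight A) ≤ X.sum (nweight A) := by
  obtain ⟨k, hkW, hk⟩ := hWE
  obtain ⟨c, hc, hck⟩ := exists_crit_of_mem_sccUnion hk
  by_cases hne : (splitLevels A (thrCT A)).Nonempty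
  · rw [thresholdGraph, if_pos hne] at hck
    exact exists_visits_crit hτ (fun s h => le_csSup ⟨_, fun _ h => splitLevels_le h⟩ h) W hW hkW
      hc hck
  · rw [thresholdGraph, if_neg hne] at hck
    obtain ⟨⟨u⟩, ⟨v⟩⟩ := hck
    cases u with
    | nil => exact ⟨W, hW, ⟨k, hkW, hc⟩, le_rfl⟩
    | cons h u =>
      -- Without split levels, the mean of any cycle through `k` can serve as the level `μ`.
      obtain ⟨Z, hZ⟩ := exists_isCycle_of_closed ((Walk.cons h u).append v) (by simp [Walk.length])
      have hempty : ∀ s, s ∉ splitLevels A (thrCT A) := fun s hs => hne ⟨s, hs⟩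
      obtain ⟨e, he, hek⟩ := List.mem_map.1 (Walk.end_mem_map_snd hZ.1)
      have he' : (thrCT A (Z.mean A)).Adj e.1 e.2 := ⟨k, Z, hZ, le_rfl, he⟩
      obtain ⟨d, hd, hdk⟩ := exists_crit_of_not_mem_splitLevels (mean_le_maxCycleMean hZ)
        (hempty _) ((thrCT A (Z.mean A)).right_mem he')
      rw [hek] at hdk
      exact exists_visits_crit hτ (fun s h => absurd h (hempty s)) W hW hkW hd hdk

/-- Walks through `K` are dominated by walks of length `t`. -/
theorem exists_long_of_strictRemoval [Fintype N] (hK : IsRepresenting A K)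
    (hτ : ∀ i, ∀ Z : Walk (graphCT A) i i, Z.IsCycle →
      ∃ τ ∈ strictRemovalLengths A Z.length Z.toGraph, τ ≤ t)
    {i j : N} (X : Walk (digraph A) i j) (hX : X.Visits K) (hXt : X.length ≡ t [MOD K.cyclicity]) :
    ∃ Y : Walk (digraph A) i j, Y.length = t ∧ X.sum (nweight A) ≤ Y.sum (nweight A) := by
  obtain ⟨k, hkX, hk⟩ := hX
  have hkc := hK.le_crit.1 hk
  have hC := isSCC_scc hkc
  -- A critical cycle has mean `λ(A)`, above or at every split level, so it belongs to `graphCT A`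
  -- and the hypothesis applies to it.
  obtain ⟨Z, hZ⟩ := crit_exists_isCycle hkc
  obtain ⟨Z₁, hZ₁⟩ := Z.exists_map (crit_le_digraph A)
  have hZ₁c := Walk.isCycle_of_edges hZ₁ hZ
  have hZ₁s : Z₁.sum (nweight A) = 0 := by rw [Walk.sum_eq_of_edges hZ₁, crit_closed_sum]
  have hmean : Z₁.mean A = maxCycleMean A := (sum_nweight_eq_zero_iff hZ₁c.1).1 hZ₁s
  have hs : ∀ s ∈ splitLevels A (thrCT A), s ≤ Z₁.mean A := fun s h => hmean ▸ splitLevels_le h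
  have hkD : k ∈ (thresholdGraph A (thrCT A)).nodes := by
    obtain ⟨e, he, hek⟩ := List.mem_map.1 (Walk.end_mem_map_snd hZ₁c.1)
    exact hek ▸ (thresholdGraph A (thrCT A)).right_mem (mem_thresholdGraph_of_mean hZ₁c hs he)
  obtain ⟨Z₂, hZ₂⟩ := exists_walk_graphCT hZ₁c hs Z₁.start_mem_support hkc (mem_scc_self hkD)
  obtain ⟨τ, hτ, hτt⟩ := hτ k Z₂ (Walk.isCycle_of_edges hZ₂ hZ₁c)
  rw [Walk.length_eq_of_edges hZ₂, Walk.toGraph_of_edges hZ₂] at hτ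
  obtain ⟨Z₃, hZ₃⟩ := exists_walk_scc (mem_scc_self hkc) (mem_scc_self hkc) Z
  have hd : (scc (crit A) k).closedWalkGcd ∣ Z₁.length := by
    rw [Walk.length_eq_of_edges hZ₁, ← Walk.length_eq_of_edges hZ₃]
    exact closedWalkGcd_dvd_length Z₃
  obtain ⟨Y, hYX, hkY, hYt, hYτ⟩ := exists_reroute hC X hkX (mem_scc_self hkc) (mem_scc_self hkc)
    hZ₁c.1 hd (hXt.of_dvd (closedWalkGcd_dvd_rep_cyclicity hK hC)) τ
  obtain ⟨V, hV, ⟨R, -, hR⟩, hmod, hVτ⟩ :=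
    hτ _ _ Y ⟨k, hkY, (Walk.mem_toGraph_nodes hZ₁c.1).2 Z₁.start_mem_support⟩ hYτ
  obtain ⟨m, hm⟩ := exists_mul_add_of_modEq (hmod.trans hYt) (hVτ.trans hτt)
  obtain ⟨V', hV', hV's, -⟩ := Walk.exists_insert_closed hZ₁c.1 hV m
  refine ⟨V', hV'.trans hm, ?_⟩
  have hle : Z₁.toGraph ≤ crit A := by
    rw [Walk.toGraph_of_edges hZ₁]
    exact ⟨fun x hx => Walk.support_subset ((Walk.mem_toGraph_nodes hZ.1).1 hx),
      fun a b hab => Walk.adj_of_mem_edges hab⟩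
  rw [hV's, hZ₁s, mul_zero, add_zero, ← hYX]
  exact hR.sum_le hle

theorem T₁_cycleThreshold_le [Fintype N] [DecidableEq N] (hK : IsRepresenting A K)
    (hT : ∀ i, ∀ Z : Walk (graphCT A) i i, Z.IsCycle → strictTcr A Z.length Z.toGraph ≤ T) :
    T₁ A K (cycleThreshold A) ≤ T := by
  refine leastNat_le fun t ht => ?_
  have hτ : ∀ i, ∀ Z : Walk (graphCT A) i i, Z.IsCycle →
      ∃ τ ∈ strictRemovalLengths A Z.length Z.toGraph, τ ≤ t := fun i Z hZ => by
    obtain ⟨τ, hτ, hle⟩ := exists_mem_le_of_leastNat_le (hT i Z hZ)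
    exact ⟨τ, hτ, hle.trans ht⟩
  refine weakCSRAt_cancel hK _ (fun i j X hX hXt => exists_long_of_strictRemoval hK hτ X hX hXt)
    fun _ i j W hW hWE => ?_
  obtain ⟨X, hX, ⟨c, hcX, hc⟩, hWX⟩ := exists_visits_crit_of_visits hτ W hW hWE
  exact ⟨X, _, isSCC_scc hc, ⟨c, hcX, mem_scc_self hc⟩, by rw [hX], hWX⟩

end CycleThreshold

end MaxPlus

/-! ### The proposition -/

open MaxPlus in
theorem proposition6p4 {N : Type*} [Fintype N] [DecidableEq N] (A : Matrix N N (WithBot ℝ))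
    (hA : ∃ i, ∃ c : Walk (digraph A) i i, c.IsCycle)
    (K : DGraph N) (hK : IsRepresenting A K) :
    (∀ G : DGraph N, IsRepresenting A G →
      ∀ γ : DGraph N → ℕ, (∀ H, DGraph.IsSCC H G → 0 < γ H ∧ H.cyclicity ∣ γ H) →
        T₁ A K (nachtigall A) ≤
            ⨆ H, ⨆ _ : DGraph.IsSCC H G, ((Tcr A (γ H) H + 1 - γ H) + ep A (γ H) H) ∧
          ∀ V, IsMaxBalancing A V →
            T₁ A K (hartmannArguelles A V) ≤
              ⨆ H, ⨆ _ : DGraph.IsSCC H G, ((Tcr A (γ H) H + 1 - γ H) + ep A (γ H) H)) ∧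
    T₁ A K (cycleThreshold A) ≤
      ⨆ i, ⨆ c : Walk (graphCT A) i i, ⨆ _ : c.IsCycle, strictTcr A c.length c.toGraph := by
  refine ⟨fun G hG γ hγ => ?_, ?_⟩
  · generalize hB : (⨆ H, ⨆ _ : DGraph.IsSCC H G,
      ((Tcr A (γ H) H + 1 - γ H) + ep A (γ H) H)) = B
    induction B using ENat.recTopCoe with
    | top => exact ⟨le_top, fun _ _ => le_top⟩
    | coe T =>
      refine T₁_nachtigall_and_hartmannArguelles_le hK hG hγ fun H hH => ?_
      rw [← hB]
      exact le_iSup₂ (f := fun H (_ : DGraph.IsSCC H G) =>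
        (Tcr A (γ H) H + 1 - γ H) + ep A (γ H) H) H hH
  · generalize hB : (⨆ i, ⨆ c : Walk (graphCT A) i i, ⨆ _ : c.IsCycle,
      strictTcr A c.length c.toGraph) = B
    induction B using ENat.recTopCoe with
    | top => exact le_top
    | coe T =>
      refine T₁_cycleThreshold_le hK fun i Z hZ => ?_
      rw [← hB]
      exact le_iSup_of_le i (le_iSup₂_of_le Z hZ le_rfl)
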